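/- \textbf{Setting.} Let $\nu$ be a measure on a measurable space $\mathcal Z$ (for example Lebesgue measure on $\mathbb R$), $\Theta\subset\mathbb R$ a compact set, $\theta_0\in\operatorname{int}\Theta$, and $f(z,\theta)>0$ $(z\in\mathcal Z,\ \theta\in\Theta)$ a family of probability densities: $\int f(z,\theta)\,d\nu(z)=1$ for all $\theta\in\Theta$. Let $Z_1,Z_2,\dots$ be i.i.d. on a probability space, with density $f(\cdot,\theta_0)$ with respect to $\nu$; $E$ is expectation at $\theta_0$. Write $\ell=\partial_\theta\log f$, $\ell^\theta=\partial_\theta^2\log f$, $\ell^{\theta\theta}=\partial^3_\theta\log f$, $\ell^{\theta\theta\theta}=\partial^4_\theta\log f$; where no argument is shown these are evaluated at $(Z_i,\theta_0)$. Let $\mathcal I=-E[\ell^\theta]$, $\mathcal Q_1=E[\ell^{\theta\theta}]$, $\mathcal Q_2=E[\ell^{\theta\theta\theta}]$, $m=(-\ell^\theta,\ \ell^{\theta\theta},\ \ell\,\ell^\theta)'$ and $\tau(t_1,t_2,t_3)=\dfrac{t_2}{2t_1^2}+\dfrac{t_3}{t_1^2}$. Assume the following. (i) For each $z$, $\log f(z,\cdot)$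 is $7$ times continuously differentiable on $\Theta$, and for all $\theta\in\Theta$ and $0\le k\le 7$ the function $z\mapsto\partial_\theta^k\log f(z,\theta)$ is measurable. (ii) There are a function $M(z)$ and a number $Q>16$ with $|\partial_\theta^k\log f(z,\theta)|\le M(z)$ for all $z$, all $\theta\in\Theta$ and $0\le k\le7$, and $E[M(Z_i)^Q]<\infty$. (iii) If $\theta\in\Theta$ and $\theta\ne\theta_0$, then $f(Z_i,\theta)$ and $f(Z_i,\theta_0)$ are not almost surely equal. (iv) $\mathcal I>0$. (v) There are a $\nu$-integrable $G$ and a neighbourhood $N$ of $\theta_0$ such that $|\partial_\theta f|$, $|\partial_\theta^2 f|$ and $|\partial_\theta(m_jf)|$, $j=1,2,3$, are at most $G(z)$ at all $(z,\theta)$ with $\theta\in N$. For each $n$ let $\widehat\theta=\widehat\theta_n$ be a maximum likelihood estimator, i.e. a random variable that almost surely lies in $\Theta$ and maximizes $n^{-1}\sum_{i=1}^n\log f(Z_i,\theta)$ over $\theta\in\Theta$. Define $$b(\theta)=\tau\Big(\int m(z,\theta)f(z,\theta)\,d\nu(z)\Big),\qquad \widehat b(\theta)=\tau\Big(\frac1n\sum_{i=1}^n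 m(Z_i,\theta)\Big),\qquad \widehat\theta_c=\widehat\theta-\frac{b(\widehat\theta)}n,\qquad \widehat\theta_a=\widehat\theta-\frac{\widehat b(\widehat\theta)}n .$$ Let $U=n^{-1/2}\sum_i\ell(Z_i,\theta_0)$, $V=n^{-1/2}\sum_i(\ell^\theta(Z_i,\theta_0)-E[\ell^\theta])$, $W=n^{-1/2}\sum_i(\ell^{\theta\theta}(Z_i,\theta_0)-E[\ell^{\theta\theta}])$ and $$A_1=\mathcal I^{-1}U,\qquad A_2=\tfrac12\mathcal I^{-3}\mathcal Q_1U^2+\mathcal I^{-2}UV,$$ $$A_3=\tfrac16\mathcal I^{-4}\mathcal Q_2U^3+\tfrac12\mathcal I^{-5}\mathcal Q_1^2U^3+\tfrac32\mathcal I^{-4}\mathcal Q_1U^2V+\tfrac12\mathcal I^{-3}U^2W+\mathcal I^{-3}UV^2 .$$ Let $\overline m=E[m(Z_i,\theta_0)]$, $\mathsf M=E[\partial_\theta m(Z_i,\theta_0)]$, $\Lambda=E[m(Z_i,\theta_0)\,\ell(Z_i,\theta_0)]$, let $\tau_m$ be the gradient (row vector) of $\tau$ at $\overline m$, and let $$\mathbb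 A_i=\tau_m\big(\mathsf M\,\mathcal I^{-1}\ell(Z_i,\theta_0)+m(Z_i,\theta_0)-\overline m\big),\qquad \mathbb C_i=\tau_m(\mathsf M+\Lambda)\,\mathcal I^{-1}\ell(Z_i,\theta_0),$$ $\mathbb A=n^{-1/2}\sum_i\mathbb A_i$, $\mathbb C=n^{-1/2}\sum_i\mathbb C_i$. \textbf{Proposition.} For every $n\ge1$, $A_2$ is integrable and $b_0:=E[A_2]=b(\theta_0)$. Both bias estimates are asymptotically linear: $E[\mathbb A_i]=E[\mathbb C_i]=0$, $E[\mathbb A_i^2]<\infty$, $E[\mathbb C_i^2]<\infty$, and as $n\to\infty$ $$\sqrt n\,(\widehat b(\widehat\theta)-b_0)=\frac1{\sqrt n}\sum_{i=1}^n\mathbb A_i+o_p(1),\qquad \sqrt n\,(b(\widehat\theta)-b_0)=\frac1{\sqrt n}\sum_{i=1}^n\mathbb C_i+o_p(1).$$ Moreover $$\sqrt n(\widehat\theta_c-\theta_0)=A_1+\frac1{\sqrt n}\big(A_2-b(\theta_0)\big)+\frac1n(A_3-\mathbb C)+o_p(n^{-1}),$$ $$\sqrt n(\widehat\theta_a-\theta_0)=A_1+\frac1{\sqrt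 n}\big(A_2-b(\theta_0)\big)+\frac1n(A_3-\mathbb A)+o_p(n^{-1}).$$ -/

import Mathlib

open MeasureTheory ProbabilityTheory Filter Topology

namespace BiasMLE

noncomputable section

/-- `∂ᵏ log f(z,θ) / ∂θᵏ`, for a family `f(z, ·)` defined on the parameter set `Θ`.
Thus `dlog 1 = ℓ`, `dlog 2 = ℓ^θ`, `dlog 3 = ℓ^θθ`, `dlog 4 = ℓ^θθθ`. -/
def dlog {𝒵 : Type*} (f : 𝒵 → ℝ → ℝ) (Θ : Set ℝ) (k : ℕ) (z : 𝒵) (θ : ℝ) : ℝ :=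
  iteratedDerivWithin k (fun t => Real.log (f z t)) Θ θ

/-- The law `P_θ` with density `f(·,θ)` with respect to `ν`. -/
def law {𝒵 : Type*} [MeasurableSpace 𝒵] (ν : Measure 𝒵) (f : 𝒵 → ℝ → ℝ) (θ : ℝ) :
    Measure 𝒵 :=
  ν.withDensity (fun z => ENNReal.ofReal (f z θ))

/-- `E[∂ᵏ log f(Z,θ₀) / ∂θᵏ]` under `P_{θ₀}`. -/
def meanDlog {𝒵 : Type*} [MeasurableSpace 𝒵] (ν : Measure 𝒵) (f : 𝒵 → ℝ → ℝ)
    (Θ : Set ℝ) (θ₀ : ℝ) (k : ℕ) : ℝ :=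
  ∫ z, dlog f Θ k z θ₀ ∂(law ν f θ₀)

/-- The information `𝓘 = -E[ℓ^θ(Z,θ₀)]`. -/
def info {𝒵 : Type*} [MeasurableSpace 𝒵] (ν : Measure 𝒵) (f : 𝒵 → ℝ → ℝ)
    (Θ : Set ℝ) (θ₀ : ℝ) : ℝ :=
  -meanDlog ν f Θ θ₀ 2

/-- The vector `m(z,θ) = (-ℓ^θ, ℓ^θθ, ℓ ℓ^θ)`. -/
def m {𝒵 : Type*} (f : 𝒵 → ℝ → ℝ) (Θ : Set ℝ) (z : 𝒵) (θ : ℝ) : Fin 3 → ℝ :=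
  ![-dlog f Θ 2 z θ, dlog f Θ 3 z θ, dlog f Θ 1 z θ * dlog f Θ 2 z θ]

/-- `τ(t₁,t₂,t₃) = t₂ / (2 t₁²) + t₃ / t₁²`. -/
def tau (t : Fin 3 → ℝ) : ℝ := t 1 / (2 * t 0 ^ 2) + t 2 / t 0 ^ 2

/-- The integral version of the bias, `b(θ) = τ(∫ m(z,θ) f(z,θ) dν(z))`. -/
def bias {𝒵 : Type*} [MeasurableSpace 𝒵] (ν : Measure 𝒵) (f : 𝒵 → ℝ → ℝ)
    (Θ : Set ℝ) (θ : ℝ) : ℝ :=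
  tau (fun j => ∫ z, m f Θ z θ j * f z θ ∂ν)

/-- The sample-average version of the bias, `b̂(θ) = τ(n⁻¹ ∑ᵢ m(Zᵢ,θ))`. -/
def biasHat {𝒵 Ω : Type*} (f : 𝒵 → ℝ → ℝ) (Θ : Set ℝ) (Z : ℕ → Ω → 𝒵)
    (n : ℕ) (ω : Ω) (θ : ℝ) : ℝ :=
  tau (fun j => (n : ℝ)⁻¹ * ∑ i ∈ Finset.range n, m f Θ (Z i ω) θ j)

/-- `m̄ = E[m(Z,θ₀)]`. -/
def mBar {𝒵 : Type*} [MeasurableSpace 𝒵] (ν : Measure 𝒵) (f : 𝒵 → ℝ → ℝ)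
    (Θ : Set ℝ) (θ₀ : ℝ) : Fin 3 → ℝ :=
  fun j => ∫ z, m f Θ z θ₀ j ∂(law ν f θ₀)

/-- `M = E[∂m(Z,θ₀)/∂θ]`. -/
def mDeriv {𝒵 : Type*} [MeasurableSpace 𝒵] (ν : Measure 𝒵) (f : 𝒵 → ℝ → ℝ)
    (Θ : Set ℝ) (θ₀ : ℝ) : Fin 3 → ℝ :=
  fun j => ∫ z, derivWithin (fun t => m f Θ z t j) Θ θ₀ ∂(law ν f θ₀)

/-- `Λ = E[m(Z,θ₀) ℓ(Z,θ₀)]`. -/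
def mScore {𝒵 : Type*} [MeasurableSpace 𝒵] (ν : Measure 𝒵) (f : 𝒵 → ℝ → ℝ)
    (Θ : Set ℝ) (θ₀ : ℝ) : Fin 3 → ℝ :=
  fun j => ∫ z, m f Θ z θ₀ j * dlog f Θ 1 z θ₀ ∂(law ν f θ₀)

/-- `τ_m = ∂τ(m̄)/∂m'`, as a linear form. -/
def tauM {𝒵 : Type*} [MeasurableSpace 𝒵] (ν : Measure 𝒵) (f : 𝒵 → ℝ → ℝ)
    (Θ : Set ℝ) (θ₀ : ℝ) : (Fin 3 → ℝ) →L[ℝ] ℝ :=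
  fderiv ℝ tau (mBar ν f Θ θ₀)

/-- The influence function of the sample-average version,
`τ_m (M 𝓘⁻¹ ℓ(z,θ₀) + m(z,θ₀) - m̄)`; `𝔸ᵢ` is its value at `Zᵢ`. -/
def inflA {𝒵 : Type*} [MeasurableSpace 𝒵] (ν : Measure 𝒵) (f : 𝒵 → ℝ → ℝ)
    (Θ : Set ℝ) (θ₀ : ℝ) (z : 𝒵) : ℝ :=
  tauM ν f Θ θ₀ (((info ν f Θ θ₀)⁻¹ * dlog f Θ 1 z θ₀) • mDeriv ν f Θ θ₀
    + (m f Θ z θ₀ - mBar ν f Θ θ₀))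

/-- The influence function of the integral version,
`τ_m (M + Λ) 𝓘⁻¹ ℓ(z,θ₀)`; `ℂᵢ` is its value at `Zᵢ`. -/
def inflC {𝒵 : Type*} [MeasurableSpace 𝒵] (ν : Measure 𝒵) (f : 𝒵 → ℝ → ℝ)
    (Θ : Set ℝ) (θ₀ : ℝ) (z : 𝒵) : ℝ :=
  tauM ν f Θ θ₀ (mDeriv ν f Θ θ₀ + mScore ν f Θ θ₀)
    * ((info ν f Θ θ₀)⁻¹ * dlog f Θ 1 z θ₀)

/-- The normalized sum `n^{-1/2} ∑_{i<n} φ(Zᵢ)`. -/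
def normSum {𝒵 Ω : Type*} (Z : ℕ → Ω → 𝒵) (φ : 𝒵 → ℝ) (n : ℕ) (ω : Ω) : ℝ :=
  (Real.sqrt n)⁻¹ * ∑ i ∈ Finset.range n, φ (Z i ω)

/-- `n^{-1/2} ∑_{i<n} (∂ᵏ log f(Zᵢ,θ₀)/∂θᵏ - E[∂ᵏ log f(Zᵢ,θ₀)/∂θᵏ])`:
this is `V(θ₀)` for `k = 2` and `W(θ₀)` for `k = 3`. -/
def centSum {𝒵 Ω : Type*} [MeasurableSpace 𝒵] (ν : Measure 𝒵) (f : 𝒵 → ℝ → ℝ)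
    (Θ : Set ℝ) (θ₀ : ℝ) (Z : ℕ → Ω → 𝒵) (k n : ℕ) (ω : Ω) : ℝ :=
  normSum Z (fun z => dlog f Θ k z θ₀ - meanDlog ν f Θ θ₀ k) n ω

/-- `A₁ = 𝓘⁻¹ U`, with `U = n^{-1/2} ∑ᵢ ℓ(Zᵢ,θ₀)`. -/
def A1 {𝒵 Ω : Type*} [MeasurableSpace 𝒵] (ν : Measure 𝒵) (f : 𝒵 → ℝ → ℝ)
    (Θ : Set ℝ) (θ₀ : ℝ) (Z : ℕ → Ω → 𝒵) (n : ℕ) (ω : Ω) : ℝ :=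
  (info ν f Θ θ₀)⁻¹ * normSum Z (fun z => dlog f Θ 1 z θ₀) n ω

/-- `A₂ = ½ 𝓘⁻³ Q₁ U² + 𝓘⁻² U V`. -/
def A2 {𝒵 Ω : Type*} [MeasurableSpace 𝒵] (ν : Measure 𝒵) (f : 𝒵 → ℝ → ℝ)
    (Θ : Set ℝ) (θ₀ : ℝ) (Z : ℕ → Ω → 𝒵) (n : ℕ) (ω : Ω) : ℝ :=
  let I := info ν f Θ θ₀
  let Q₁ := meanDlog ν f Θ θ₀ 3
  let U := normSum Z (fun z => dlog f Θ 1 z θ₀) n ω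
  let V := centSum ν f Θ θ₀ Z 2 n ω
  1 / 2 * I⁻¹ ^ 3 * Q₁ * U ^ 2 + I⁻¹ ^ 2 * U * V

/-- `A₃ = ⅙ 𝓘⁻⁴ Q₂ U³ + ½ 𝓘⁻⁵ Q₁² U³ + (3/2) 𝓘⁻⁴ Q₁ U² V + ½ 𝓘⁻³ U² W + 𝓘⁻³ U V²`. -/
def A3 {𝒵 Ω : Type*} [MeasurableSpace 𝒵] (ν : Measure 𝒵) (f : 𝒵 → ℝ → ℝ)
    (Θ : Set ℝ) (θ₀ : ℝ) (Z : ℕ → Ω → 𝒵) (n : ℕ) (ω : Ω) : ℝ :=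
  let I := info ν f Θ θ₀
  let Q₁ := meanDlog ν f Θ θ₀ 3
  let Q₂ := meanDlog ν f Θ θ₀ 4
  let U := normSum Z (fun z => dlog f Θ 1 z θ₀) n ω
  let V := centSum ν f Θ θ₀ Z 2 n ω
  let W := centSum ν f Θ θ₀ Z 3 n ω
  1 / 6 * I⁻¹ ^ 4 * Q₂ * U ^ 3 + 1 / 2 * I⁻¹ ^ 5 * Q₁ ^ 2 * U ^ 3
    + 3 / 2 * I⁻¹ ^ 4 * Q₁ * U ^ 2 * V + 1 / 2 * I⁻¹ ^ 3 * U ^ 2 * W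
    + I⁻¹ ^ 3 * U * V ^ 2

/-- `X_n = o_p(r_n)`: `X_n / r_n` tends to `0` in probability. -/
def IsLittleOp {Ω : Type*} [MeasurableSpace Ω] (P : Measure Ω) (X : ℕ → Ω → ℝ)
    (r : ℕ → ℝ) : Prop :=
  TendstoInMeasure P (fun n ω => X n ω / r n) atTop (fun _ => 0)

/-- The estimator `bEst` of `b₀` is asymptotically linear with influence function `φ`
(mean zero, finite variance under the law `F₀` of the data):
`√n (bEst - b₀) = n^{-1/2} ∑ᵢ φ(Zᵢ) + o_p(1)`. -/
def AsymptoticallyLinear {𝒵 Ω : Type*} [MeasurableSpace 𝒵] [MeasurableSpace Ω]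
    (P : Measure Ω) (F₀ : Measure 𝒵) (Z : ℕ → Ω → 𝒵) (bEst : ℕ → Ω → ℝ) (b₀ : ℝ)
    (φ : 𝒵 → ℝ) : Prop :=
  MemLp φ 2 F₀ ∧ ∫ z, φ z ∂F₀ = 0 ∧
    IsLittleOp P (fun n ω => Real.sqrt n * (bEst n ω - b₀) - normSum Z φ n ω) (fun _ => 1)

/-- `θhat n` is a maximum likelihood estimator from `Z₀, …, Z_{n-1}`: a random variable that
almost surely maximizes the average log-likelihood over `Θ`. -/
def IsMLE {𝒵 Ω : Type*} [MeasurableSpace Ω] (P : Measure Ω) (f : 𝒵 → ℝ → ℝ)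
    (Θ : Set ℝ) (Z : ℕ → Ω → 𝒵) (θhat : ℕ → Ω → ℝ) : Prop :=
  ∀ n, AEMeasurable (θhat n) P ∧ ∀ᵐ ω ∂P, θhat n ω ∈ Θ ∧
    IsMaxOn (fun θ => (n : ℝ)⁻¹ * ∑ i ∈ Finset.range n, Real.log (f (Z i ω) θ)) Θ (θhat n ω)

/-- The regularity conditions on the parametric family `f(·,θ)`, `θ ∈ Θ`, of densities with
respect to `ν`, and on the true parameter `θ₀`. -/
structure Regular {𝒵 : Type*} [MeasurableSpace 𝒵] (ν : Measure 𝒵) (f : 𝒵 → ℝ → ℝ)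
    (Θ : Set ℝ) (θ₀ : ℝ) : Prop where
  pos : ∀ z, ∀ θ ∈ Θ, 0 < f z θ
  density : ∀ θ ∈ Θ, ∫ z, f z θ ∂ν = 1
  smooth : ∀ z, ContDiffOn ℝ 7 (fun θ => Real.log (f z θ)) Θ
  compact : IsCompact Θ
  mem_interior : θ₀ ∈ interior Θ
  envelope : ∃ (M : 𝒵 → ℝ) (Q : ℝ), 16 < Q ∧
    Integrable (fun z => M z ^ Q) (law ν f θ₀) ∧
    ∀ z, ∀ θ ∈ Θ, ∀ k ≤ 7, |dlog f Θ k z θ| ≤ M z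
  identified : ∀ θ ∈ Θ, θ ≠ θ₀ → ¬ (fun z => f z θ) =ᵐ[law ν f θ₀] (fun z => f z θ₀)
  measurable : ∀ θ ∈ Θ, ∀ k ≤ 7, Measurable (fun z => dlog f Θ k z θ)
  /-- The information does not vanish. -/
  info_pos : 0 < info ν f Θ θ₀
  /-- Near `θ₀`, the `θ`-derivatives of the integrands of `∫ f(z,θ) dν` (first and second
  derivative) and of `∫ m(z,θ) f(z,θ) dν` (first derivative) are dominated. -/
  dominated : ∃ G : 𝒵 → ℝ, Integrable G ν ∧ ∀ᶠ θ in 𝓝 θ₀, ∀ z,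
    |iteratedDerivWithin 1 (f z) Θ θ| ≤ G z ∧ |iteratedDerivWithin 2 (f z) Θ θ| ≤ G z ∧
      ∀ j, |derivWithin (fun t => m f Θ z t j * f z t) Θ θ| ≤ G z

end

end BiasMLE

/-!
# Higher-order expansion of bias-corrected maximum likelihood estimators

Convergence in probability is treated as convergence along a filter `inProb P` on `ℕ × Ω`, whose
members are the events of probability tending to one. Together with the class `BddInProb` of
`O_p(1)` sequences, which is stable under polynomial operations and absorbs factors that tend to
zero, this turns the stochastic expansions into algebra with exact identities.

*Bias.* Differentiating `∫ f(z,θ) dν = 1` twice under the integral gives `E[ℓ] = 0` and the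
information identity `E[ℓ²] = 𝓘`. Hence `E[U²] = 𝓘` and `E[UV] = E[ℓ ℓ^θ]`, as only diagonal terms of
the double sums survive, and `E[A₂]` is `τ` at `m̄` (`Regular.integral_A2`).

*Consistency* is Wald's argument (`Regular.consistent`): the Kullback–Leibler divergence is positive
off `θ₀`, the supremum of the log density over a small neighbourhood of `θ₁ ≠ θ₀` still has a mean
below that of the log density at `θ₀`, and finitely many such neighbourhoods cover the rest of the
compact set `Θ`.

*Expansion of `θ̂`.* By consistency the score vanishes at `θ̂` with probability tending to one. A
first-order Taylor expansion of the score, with a remainder bounded by the average of the envelope,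
gives `D = √n (θ̂ - θ₀) = O_p(1)` (`Regular.bddInProb_estimation_error`). The third-order expansion is
then an equation for `D` in powers of `n^{-1/2}` with `O_p(1)` coefficients, and substituting it three
times into itself produces `A₁`, `A₂`, `A₃` (`score_expansion_solve`, `Regular.mle_expansion`).

*Bias estimates.* The function `b` is differentiable at `θ₀` with derivative `τ_m(M + Λ)`, the `θ` in
`∫ m f dν` being differentiated in `m` and in `f`; the sample average of `m(Zᵢ, θ̂)` is linearized by a
Taylor expansion and the law of large numbers. The delta method then gives `Regular.bias_linear`
and `Regular.biasHat_linear`. Subtracting `bEst / n` from `θ̂` shifts the expansion at order `n^{-1/2}`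
by `b₀` and at order `n⁻¹` by the linear part of `bEst` (`Regular.corrected_expansion`).
-/


namespace BiasMLE

/-! ### Stochastic orders of magnitude -/

section StochasticOrder

variable {Ω : Type*} [MeasurableSpace Ω] {P : Measure Ω}
variable {E F : Type*} [NormedAddCommGroup E] [NormedAddCommGroup F]

/-- The filter on `ℕ × Ω` of the events whose probability at stage `n` tends to one. A random
sequence, viewed as a function on `ℕ × Ω`, converges along this filter to a constant if and only
if it converges to it in probability. -/
def inProb (P : Measure Ω) : Filter (ℕ × Ω) where
  sets := {S | Tendsto (fun n => P {ω | (n, ω) ∉ S}) atTop (𝓝 0)}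
  univ_sets := by simp
  sets_of_superset := by
    intro S T hS hST
    exact tendsto_of_tendsto_of_tendsto_of_le_of_le tendsto_const_nhds hS
      (fun _ => zero_le) (fun n => measure_mono fun ω h h' => h (hST h'))
  inter_sets := by
    intro S T hS hT
    have h := Tendsto.add hS hT
    rw [add_zero] at h
    refine tendsto_of_tendsto_of_tendsto_of_le_of_le tendsto_const_nhds h
      (fun _ => zero_le) (fun n => ?_)
    refine (measure_mono fun ω hω => ?_).trans (measure_union_le _ _)
    by_contra hcon
    simp only [Set.mem_union, Set.mem_ofPred_eq, not_or, not_not] at hcon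
    exact hω ⟨hcon.1, hcon.2⟩

lemma eventually_inProb {p : ℕ × Ω → Prop} :
    (∀ᶠ x in inProb P, p x) ↔ Tendsto (fun n => P {ω | ¬ p (n, ω)}) atTop (𝓝 0) := Iff.rfl

lemma tendsto_fst_inProb : Tendsto (Prod.fst : ℕ × Ω → ℕ) (inProb P) atTop := by
  intro S hS
  refine eventually_inProb.2 (tendsto_const_nhds.congr' ?_)
  filter_upwards [hS] with n hn
  simp [hn]

lemma eventually_inProb_of_ae {p : ℕ × Ω → Prop} (h : ∀ n, ∀ᵐ ω ∂P, p (n, ω)) :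
    ∀ᶠ x in inProb P, p x :=
  eventually_inProb.2 (tendsto_const_nhds.congr fun n => (ae_iff.1 (h n)).symm)

lemma tendsto_inProb_iff {X : ℕ × Ω → E} :
    Tendsto X (inProb P) (𝓝 0) ↔
      TendstoInMeasure P (fun n ω => X (n, ω)) atTop (fun _ => 0) := by
  rw [tendstoInMeasure_iff_norm, NormedAddGroup.tendsto_nhds_zero]
  simp only [eventually_inProb, not_lt, sub_zero, gt_iff_lt]

/-- `X = O_p(1)`: boundedness in probability (asymptotic tightness) of a random sequence. -/
def BddInProb (P : Measure Ω) (X : ℕ × Ω → E) : Prop :=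
  ∀ ε : ENNReal, 0 < ε → ∃ C : ℝ, ∀ᶠ n in atTop, P {ω | C < ‖X (n, ω)‖} ≤ ε

namespace BddInProb

/-- A sequence is `O_p(1)` if, with probability tending to one, it is bounded by a constant that
depends only on bounds for two `O_p(1)` sequences. -/
lemma of_le₂ {X : ℕ × Ω → E} {Y : ℕ × Ω → F} {W : ℕ × Ω → ℝ}
    (hX : BddInProb P X) (hY : BddInProb P Y) (φ : ℝ → ℝ → ℝ)
    (h : ∀ a b, ∀ᶠ x in inProb P, ‖X x‖ ≤ a → ‖Y x‖ ≤ b → ‖W x‖ ≤ φ a b) :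
    BddInProb P W := by
  intro ε hε
  have hε3 : 0 < ε / 3 := ENNReal.div_pos hε.ne' (by simp)
  obtain ⟨a, ha⟩ := hX _ hε3
  obtain ⟨b, hb⟩ := hY _ hε3
  refine ⟨φ a b, ?_⟩
  have h3 := (eventually_inProb.1 (h a b)).eventually_lt_const hε3
  filter_upwards [ha, hb, h3] with n h1 h2 h3
  calc P {ω | φ a b < ‖W (n, ω)‖}
      ≤ P ({ω | a < ‖X (n, ω)‖} ∪ {ω | b < ‖Y (n, ω)‖} ∪
          {ω | ¬ (‖X (n, ω)‖ ≤ a → ‖Y (n, ω)‖ ≤ b → ‖W (n, ω)‖ ≤ φ a b)}) := by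
        refine measure_mono fun ω hω => ?_
        simp only [Set.mem_ofPred_eq, Set.mem_union] at hω ⊢
        by_contra hcon
        push Not at hcon
        exact absurd (hcon.2 hcon.1.1 hcon.1.2) (not_le.2 hω)
    _ ≤ ε / 3 + ε / 3 + ε / 3 :=
        (measure_union_le _ _).trans
          (add_le_add ((measure_union_le _ _).trans (add_le_add h1 h2)) h3.le)
    _ = ε := ENNReal.add_thirds ε

lemma of_norm_le {X : ℕ × Ω → E} {W : ℕ × Ω → ℝ} (hX : BddInProb P X)
    (h : ∀ᶠ x in inProb P, ‖W x‖ ≤ ‖X x‖) : BddInProb P W :=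
  hX.of_le₂ hX (fun a _ => a) fun a b => by
    filter_upwards [h] with x hx h1 _ using hx.trans h1

lemma const (c : E) : BddInProb P (fun _ => c) := fun ε _ => ⟨‖c‖, by simp⟩

lemma add {X Y : ℕ × Ω → ℝ} (hX : BddInProb P X) (hY : BddInProb P Y) :
    BddInProb P (fun x => X x + Y x) :=
  hX.of_le₂ hY (fun a b => a + b) fun _ _ => Eventually.of_forall fun _ h1 h2 =>
    (norm_add_le _ _).trans (add_le_add h1 h2)

lemma mul {X Y : ℕ × Ω → ℝ} (hX : BddInProb P X) (hY : BddInProb P Y) :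
    BddInProb P (fun x => X x * Y x) :=
  hX.of_le₂ hY (fun a b => a * b) fun _ _ => Eventually.of_forall fun x h1 h2 => by
    rw [norm_mul]
    exact mul_le_mul h1 h2 (norm_nonneg _) ((norm_nonneg _).trans h1)

lemma const_mul {X : ℕ × Ω → ℝ} (hX : BddInProb P X) (c : ℝ) :
    BddInProb P (fun x => c * X x) := (const c).mul hX

lemma pow {X : ℕ × Ω → ℝ} (hX : BddInProb P X) (k : ℕ) : BddInProb P (fun x => X x ^ k) := by
  induction k with
  | zero => simpa using const (P := P) (1 : ℝ)
  | succ k ih => simpa only [pow_succ] using ih.mul hX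

lemma of_tendsto {X : ℕ × Ω → E} {c : E} (hX : Tendsto X (inProb P) (𝓝 c)) :
    BddInProb P X := by
  intro ε hε
  refine ⟨‖c‖ + 1, ?_⟩
  have h1 : ∀ᶠ x in inProb P, ‖X x‖ < ‖c‖ + 1 :=
    hX.norm.eventually_lt_const (by linarith)
  filter_upwards [(eventually_inProb.1 h1).eventually_lt_const hε] with n hn
  exact (measure_mono fun ω hω => not_lt.2 (le_of_lt hω)).trans hn.le

lemma pi {X : ℕ × Ω → Fin 3 → ℝ} (h : ∀ j, BddInProb P (fun x => X x j)) : BddInProb P X := by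
  have hs : BddInProb P (fun x => ‖X x 0‖ + ‖X x 1‖ + ‖X x 2‖) := by
    have hn : ∀ j, BddInProb P (fun x => ‖X x j‖) := fun j =>
      (h j).of_norm_le (Eventually.of_forall fun x => by simp)
    exact ((hn 0).add (hn 1)).add (hn 2)
  intro ε hε
  obtain ⟨C, hC⟩ := hs ε hε
  refine ⟨C, hC.mono fun n hn => (measure_mono fun ω hω => ?_).trans hn⟩
  have hω' : C < ‖X (n, ω)‖ := hω
  refine lt_of_lt_of_le hω' ?_
  rw [Real.norm_of_nonneg (by positivity)]
  refine (pi_norm_le_iff_of_nonneg (by positivity)).2 fun j => ?_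
  have h0 := norm_nonneg (X (n, ω) 0)
  have h1 := norm_nonneg (X (n, ω) 1)
  have h2 := norm_nonneg (X (n, ω) 2)
  fin_cases j <;> simp only [Fin.zero_eta, Fin.mk_one, Fin.reduceFinMk] <;> linarith

/-- `o(X) = o_p(1)` for `X = O_p(1)`. -/
lemma tendsto_of_isLittleO {X : ℕ × Ω → E} {W : ℕ × Ω → F} (hX : BddInProb P X)
    (h : W =o[inProb P] X) : Tendsto W (inProb P) (𝓝 0) := by
  rw [NormedAddGroup.tendsto_nhds_zero]
  intro η hη
  rw [eventually_inProb]
  refine ENNReal.tendsto_nhds_zero.2 fun ε hε => ?_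
  have hε2 : 0 < ε / 2 := ENNReal.div_pos hε.ne' (by simp)
  obtain ⟨C, hC⟩ := hX _ hε2
  have hC1 : 0 < |C| + 1 := by positivity
  have h2 := (eventually_inProb.1 (h.def (c := η / (2 * (|C| + 1))) (by positivity)))
  filter_upwards [hC, h2.eventually_lt_const hε2] with n h1 h2
  rw [← ENNReal.add_halves ε]
  refine le_trans (measure_mono fun ω hω => ?_) ((measure_union_le _ _).trans
    (add_le_add h1 h2.le))
  by_contra hcon
  simp only [Set.mem_union, Set.mem_ofPred_eq, not_or, not_not, not_lt] at hcon hω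
  have h3 : ‖X (n, ω)‖ ≤ |C| + 1 := hcon.1.trans ((le_abs_self C).trans (by linarith))
  have h4 : η ≤ η / (2 * (|C| + 1)) * (|C| + 1) :=
    hω.trans (hcon.2.trans (by gcongr))
  have h5 : η / (2 * (|C| + 1)) * (|C| + 1) = η / 2 := by field_simp
  linarith

lemma tendsto_smul [NormedSpace ℝ E] {X : ℕ × Ω → E} {Y : ℕ × Ω → ℝ} (hX : BddInProb P X)
    (hY : Tendsto Y (inProb P) (𝓝 0)) : Tendsto (fun x => Y x • X x) (inProb P) (𝓝 0) := by
  refine hX.tendsto_of_isLittleO ?_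
  have := ((Asymptotics.isLittleO_one_iff ℝ).2 hY).smul_isBigO
    (Asymptotics.isBigO_refl X (inProb P))
  simpa using this

/-- The delta method: if `X = O_p(1)` and `s → 0`, then
`F(a + s X) = F(a) + s F'(a) X + o_p(s)`. -/
lemma delta_method [NormedSpace ℝ E] [NormedSpace ℝ F] {X : ℕ × Ω → E}
    (hX : BddInProb P X) {s : ℕ → ℝ}
    (hs : Tendsto s atTop (𝓝 0)) {G : E → F} {G' : E →L[ℝ] F} {a : E} (hG : HasFDerivAt G G' a) :
    Tendsto (fun x => (s x.1)⁻¹ • (G (a + s x.1 • X x) - G a - G' (s x.1 • X x)))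
      (inProb P) (𝓝 0) := by
  have h0 : Tendsto (fun x : ℕ × Ω => s x.1 • X x) (inProb P) (𝓝 0) :=
    hX.tendsto_smul (hs.comp tendsto_fst_inProb)
  have h1 := (hasFDerivAt_iff_isLittleO_nhds_zero.1 hG).comp_tendsto h0
  refine hX.tendsto_of_isLittleO (Asymptotics.IsLittleO.of_bound fun c hc => ?_)
  filter_upwards [h1.def hc] with x hx
  simp only [Function.comp_apply] at hx
  rw [norm_smul, norm_inv]
  rcases eq_or_ne (s x.1) 0 with h | h
  · simp [h]; positivity
  · rw [norm_smul] at hx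
    have : 0 < ‖s x.1‖ := norm_pos_iff.2 h
    calc ‖s x.1‖⁻¹ * ‖G (a + s x.1 • X x) - G a - G' (s x.1 • X x)‖
        ≤ ‖s x.1‖⁻¹ * (c * (‖s x.1‖ * ‖X x‖)) := by gcongr
      _ = c * ‖X x‖ := by field_simp

end BddInProb

lemma tendsto_inv_sqrt_nat : Tendsto (fun n : ℕ => (Real.sqrt n)⁻¹) atTop (𝓝 0) :=
  tendsto_inv_atTop_zero.comp (Real.tendsto_sqrt_atTop.comp tendsto_natCast_atTop_atTop)

end StochasticOrder

/-! ### Sums of independent, identically distributed terms -/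

section Average

variable {𝒵 Ω : Type*} {Z : ℕ → Ω → 𝒵}

/-- The sample average `n⁻¹ ∑_{i<n} φ(Zᵢ)`. -/
noncomputable def avg (Z : ℕ → Ω → 𝒵) (φ : 𝒵 → ℝ) (n : ℕ) (ω : Ω) : ℝ :=
  (n : ℝ)⁻¹ * ∑ i ∈ Finset.range n, φ (Z i ω)

lemma avg_add (φ ψ : 𝒵 → ℝ) (n : ℕ) (ω : Ω) :
    avg Z (fun z => φ z + ψ z) n ω = avg Z φ n ω + avg Z ψ n ω := by
  simp [avg, Finset.sum_add_distrib, mul_add]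

lemma avg_sub (φ ψ : 𝒵 → ℝ) (n : ℕ) (ω : Ω) :
    avg Z (fun z => φ z - ψ z) n ω = avg Z φ n ω - avg Z ψ n ω := by
  simp [avg, Finset.sum_sub_distrib, mul_sub]

lemma avg_mul_const (φ : 𝒵 → ℝ) (c : ℝ) (n : ℕ) (ω : Ω) :
    avg Z (fun z => φ z * c) n ω = avg Z φ n ω * c := by
  simp [avg, Finset.sum_mul, mul_assoc]

lemma avg_mono {φ ψ : 𝒵 → ℝ} (h : ∀ z, φ z ≤ ψ z) (n : ℕ) (ω : Ω) :
    avg Z φ n ω ≤ avg Z ψ n ω :=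
  mul_le_mul_of_nonneg_left (Finset.sum_le_sum fun _ _ => h _) (by positivity)

lemma abs_avg_le {φ ψ : 𝒵 → ℝ} (h : ∀ z, |φ z| ≤ ψ z) (n : ℕ) (ω : Ω) :
    |avg Z φ n ω| ≤ avg Z ψ n ω := by
  unfold avg
  rw [abs_mul, abs_of_nonneg (by positivity : (0 : ℝ) ≤ (n : ℝ)⁻¹)]
  exact mul_le_mul_of_nonneg_left
    ((Finset.abs_sum_le_sum_abs _ _).trans (Finset.sum_le_sum fun _ _ => h _)) (by positivity)

/-- A sample average is its expectation plus `n^{-1/2}` times the normalized centred sum. -/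
lemma avg_eq_add_normSum (φ : 𝒵 → ℝ) (c : ℝ) {n : ℕ} (hn : 0 < n) (ω : Ω) :
    avg Z φ n ω = c + (Real.sqrt n)⁻¹ * normSum Z (fun z => φ z - c) n ω := by
  have hn' : (0 : ℝ) < n := Nat.cast_pos.2 hn
  have h1 : (Real.sqrt n)⁻¹ * (Real.sqrt n)⁻¹ = (n : ℝ)⁻¹ := by
    rw [← mul_inv, Real.mul_self_sqrt hn'.le]
  rw [normSum, ← mul_assoc, h1, avg, Finset.sum_sub_distrib]
  simp only [Finset.sum_const, Finset.card_range, nsmul_eq_mul]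
  field_simp
  ring

lemma normSum_mul_normSum (φ ψ : 𝒵 → ℝ) (n : ℕ) (ω : Ω) :
    normSum Z φ n ω * normSum Z ψ n ω = (n : ℝ)⁻¹ *
      ∑ i ∈ Finset.range n, ∑ j ∈ Finset.range n, φ (Z i ω) * ψ (Z j ω) := by
  have h1 : (Real.sqrt n)⁻¹ * (Real.sqrt n)⁻¹ = (n : ℝ)⁻¹ := by
    rw [← mul_inv, Real.mul_self_sqrt (Nat.cast_nonneg n)]
  rw [normSum, normSum, ← Finset.sum_mul_sum, ← h1]
  ring

end Average

section IID

variable {𝒵 Ω : Type*} [MeasurableSpace 𝒵] [MeasurableSpace Ω] {P : Measure Ω} {μ : Measure 𝒵}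
  {Z : ℕ → Ω → 𝒵}

lemma integrable_comp (hlaw : ∀ i, HasLaw (Z i) μ P) {φ : 𝒵 → ℝ} (hφ : Integrable φ μ) (i : ℕ) :
    Integrable (fun ω => φ (Z i ω)) P := by
  have h : Integrable φ (P.map (Z i)) := by rwa [(hlaw i).map_eq]
  exact (integrable_map_measure h.aestronglyMeasurable (hlaw i).aemeasurable).1 h

lemma memLp_two_comp (hlaw : ∀ i, HasLaw (Z i) μ P) {φ : 𝒵 → ℝ} (hφ : MemLp φ 2 μ) (i : ℕ) :
    MemLp (fun ω => φ (Z i ω)) 2 P := by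
  have h : MemLp φ 2 (P.map (Z i)) := by rwa [(hlaw i).map_eq]
  exact (memLp_map_measure_iff h.aestronglyMeasurable (hlaw i).aemeasurable).1 h

lemma integral_comp_eq (hlaw : ∀ i, HasLaw (Z i) μ P) {φ : 𝒵 → ℝ}
    (hφ : AEStronglyMeasurable φ μ) (i : ℕ) : ∫ ω, φ (Z i ω) ∂P = ∫ z, φ z ∂μ :=
  (hlaw i).integral_comp hφ

lemma integrable_normSum_mul_normSum (hlaw : ∀ i, HasLaw (Z i) μ P) {φ ψ : 𝒵 → ℝ}
    (hφ : MemLp φ 2 μ) (hψ : MemLp ψ 2 μ) (n : ℕ) :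
    Integrable (fun ω => normSum Z φ n ω * normSum Z ψ n ω) P := by
  simp only [normSum_mul_normSum]
  exact (integrable_finsetSum _ fun i _ => integrable_finsetSum _ fun j _ =>
    (memLp_two_comp hlaw hφ i).integrable_mul (memLp_two_comp hlaw hψ j)).const_mul _

/-- Only the diagonal of the double sum contributes to `E[n^{-1/2} ∑ φ(Zᵢ) · n^{-1/2} ∑ ψ(Zⱼ)]`,
by independence and because `φ(Zᵢ)` has mean zero. -/
lemma integral_normSum_mul_normSum [IsProbabilityMeasure P] (hindep : iIndepFun Z P)
    (hlaw : ∀ i, HasLaw (Z i) μ P) {φ ψ : 𝒵 → ℝ} (hφ : MemLp φ 2 μ) (hψ : MemLp ψ 2 μ)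
    (hφ0 : ∫ z, φ z ∂μ = 0) {n : ℕ} (hn : 0 < n) :
    ∫ ω, normSum Z φ n ω * normSum Z ψ n ω ∂P = ∫ z, φ z * ψ z ∂μ := by
  have hint : ∀ i j, Integrable (fun ω => φ (Z i ω) * ψ (Z j ω)) P := fun i j =>
    (memLp_two_comp hlaw hφ i).integrable_mul (memLp_two_comp hlaw hψ j)
  have hterm : ∀ i j, ∫ ω, φ (Z i ω) * ψ (Z j ω) ∂P =
      if i = j then ∫ z, φ z * ψ z ∂μ else 0 := by
    intro i j
    split_ifs with hij
    · subst hij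
      exact integral_comp_eq hlaw (hφ.aestronglyMeasurable.mul hψ.aestronglyMeasurable) i
    · rw [(hindep.indepFun hij).integral_fun_comp_mul_comp (hlaw i).aemeasurable
        (hlaw j).aemeasurable (by rw [(hlaw i).map_eq]; exact hφ.aestronglyMeasurable)
        (by rw [(hlaw j).map_eq]; exact hψ.aestronglyMeasurable),
        integral_comp_eq hlaw hφ.aestronglyMeasurable, hφ0, zero_mul]
  simp only [normSum_mul_normSum]
  rw [integral_const_mul, integral_finsetSum _ fun i _ => integrable_finsetSum _ fun j _ => hint i j]
  have h2 : ∀ i ∈ Finset.range n, ∫ ω, ∑ j ∈ Finset.range n, φ (Z i ω) * ψ (Z j ω) ∂P =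
      ∫ z, φ z * ψ z ∂μ := by
    intro i hi
    rw [integral_finsetSum _ fun j _ => hint i j]
    simp only [hterm, Finset.sum_ite_eq, if_pos hi]
  have hn' : (n : ℝ) ≠ 0 := Nat.cast_ne_zero.2 hn.ne'
  rw [Finset.sum_congr rfl h2, Finset.sum_const, Finset.card_range, nsmul_eq_mul,
    inv_mul_cancel_left₀ hn']

/-- Markov's inequality: nonnegative variables with bounded expectations are `O_p(1)`. -/
lemma BddInProb.of_integral_le [IsProbabilityMeasure P] {X : ℕ × Ω → ℝ} (h0 : ∀ x, 0 ≤ X x)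
    (hint : ∀ n, Integrable (fun ω => X (n, ω)) P) {B : ℝ}
    (hB : ∀ n, 0 < n → ∫ ω, X (n, ω) ∂P ≤ B) : BddInProb P X := by
  intro ε hε
  rcases eq_or_ne ε ⊤ with rfl | hεtop
  · exact ⟨0, by simp⟩
  have hr : 0 < ε.toReal := ENNReal.toReal_pos hε.ne' hεtop
  refine ⟨(|B| + 1) / ε.toReal, ?_⟩
  filter_upwards [eventually_gt_atTop 0] with n hn
  set C := (|B| + 1) / ε.toReal with hC
  have hC0 : 0 < C := by positivity
  have h1 := mul_meas_ge_le_integral_of_nonneg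
    (Eventually.of_forall fun ω => h0 (n, ω)) (hint n) C
  have h2 : C * P.real {ω | C ≤ X (n, ω)} ≤ C * ε.toReal := by
    have h3 : C * ε.toReal = |B| + 1 := by rw [hC]; field_simp
    rw [h3]
    linarith [hB n hn, le_abs_self B]
  have h3 : P.real {ω | C ≤ X (n, ω)} ≤ ε.toReal := le_of_mul_le_mul_left h2 hC0
  have h4 : P {ω | C ≤ X (n, ω)} ≤ ε := by
    rw [measureReal_def] at h3
    exact (ENNReal.toReal_le_toReal (measure_ne_top _ _) hεtop).1 h3
  refine (measure_mono fun ω hω => ?_).trans h4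
  have hω' : C < ‖X (n, ω)‖ := hω
  rw [Real.norm_of_nonneg (h0 _)] at hω'
  exact hω'.le

lemma bddInProb_normSum [IsProbabilityMeasure P] (hindep : iIndepFun Z P)
    (hlaw : ∀ i, HasLaw (Z i) μ P) {φ : 𝒵 → ℝ} (hφ : MemLp φ 2 μ) (hφ0 : ∫ z, φ z ∂μ = 0) :
    BddInProb P (fun x => normSum Z φ x.1 x.2) := by
  have h : BddInProb P (fun x => normSum Z φ x.1 x.2 * normSum Z φ x.1 x.2) :=
    BddInProb.of_integral_le (fun x => mul_self_nonneg _)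
      (integrable_normSum_mul_normSum hlaw hφ hφ)
      (fun n hn => (integral_normSum_mul_normSum hindep hlaw hφ hφ hφ0 hn).le)
  refine (h.add (BddInProb.const 1)).of_norm_le (Eventually.of_forall fun x => ?_)
  rw [Real.norm_eq_abs, Real.norm_of_nonneg (by nlinarith [mul_self_nonneg (normSum Z φ x.1 x.2)])]
  nlinarith [sq_nonneg (|normSum Z φ x.1 x.2| - 1), abs_mul_abs_self (normSum Z φ x.1 x.2)]

lemma bddInProb_avg [IsProbabilityMeasure P] (hlaw : ∀ i, HasLaw (Z i) μ P) {φ : 𝒵 → ℝ}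
    (hφ : Integrable φ μ) : BddInProb P (fun x => avg Z φ x.1 x.2) := by
  have h : BddInProb P (fun x => avg Z (fun z => |φ z|) x.1 x.2) := by
    refine BddInProb.of_integral_le (B := ∫ z, |φ z| ∂μ)
      (fun x => mul_nonneg (by positivity) (Finset.sum_nonneg fun _ _ => abs_nonneg _))
      (fun n => by
        simp only [avg]
        exact (integrable_finsetSum _ fun i _ => integrable_comp hlaw hφ.abs i).const_mul _)
      (fun n hn => ?_)
    have hn' : (n : ℝ) ≠ 0 := Nat.cast_ne_zero.2 hn.ne'
    simp only [avg]
    rw [integral_const_mul, integral_finsetSum _ fun i _ => integrable_comp hlaw hφ.abs i]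
    simp only [integral_comp_eq hlaw hφ.abs.aestronglyMeasurable, Finset.sum_const,
      Finset.card_range, nsmul_eq_mul, inv_mul_cancel_left₀ hn', le_refl]
  refine h.of_norm_le (Eventually.of_forall fun x => ?_)
  exact (abs_avg_le (fun _ => le_rfl) _ _).trans (le_abs_self _)

lemma eventually_fst_pos : ∀ᶠ x in inProb P, 0 < x.1 :=
  tendsto_fst_inProb.eventually (eventually_gt_atTop 0)

/-- The weak law of large numbers for a square integrable function of the data. -/
lemma tendsto_avg_inProb [IsProbabilityMeasure P] (hindep : iIndepFun Z P)
    (hlaw : ∀ i, HasLaw (Z i) μ P) {φ : 𝒵 → ℝ} (hφ : MemLp φ 2 μ) :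
    Tendsto (fun x : ℕ × Ω => avg Z φ x.1 x.2) (inProb P) (𝓝 (∫ z, φ z ∂μ)) := by
  have : IsProbabilityMeasure μ := (hlaw 0).isProbabilityMeasure_iff.1 ‹_›
  set c := ∫ z, φ z ∂μ with hc
  have hφc : MemLp (fun z => φ z - c) 2 μ := hφ.sub (memLp_const c)
  have h0 : ∫ z, (φ z - c) ∂μ = 0 := by
    rw [integral_sub (hφ.integrable (by norm_num)) (integrable_const c)]
    simp [hc]
  have h1 := (bddInProb_normSum hindep hlaw hφc h0).tendsto_smul
    (tendsto_inv_sqrt_nat.comp tendsto_fst_inProb)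
  have h2 := h1.const_add c
  rw [add_zero] at h2
  refine h2.congr' ?_
  filter_upwards [eventually_fst_pos] with x hx
  rw [avg_eq_add_normSum φ c hx]
  rfl

end IID

/-! ### Taylor expansion with a remainder bounded by the envelope -/

section Taylor

variable {a δ C : ℝ}

/-- One integration step of Taylor's formula: a function that vanishes at `a` and whose derivative
is `O(|t - a|ᵏ)` is `O(|t - a|ᵏ⁺¹)`, with the same constant. -/
lemma abs_le_pow_succ_of_hasDerivAt (hC : 0 ≤ C) {h h' : ℝ → ℝ} {k : ℕ} (h0 : h a = 0)
    (hd : ∀ t ∈ Metric.ball a δ, HasDerivAt h (h' t) t)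
    (hb : ∀ t ∈ Metric.ball a δ, |h' t| ≤ C * |t - a| ^ k) {t : ℝ} (ht : t ∈ Metric.ball a δ) :
    |h t| ≤ C * |t - a| ^ (k + 1) := by
  have ha : a ∈ Metric.ball a δ := Metric.mem_ball_self (dist_nonneg.trans_lt ht)
  have hseg : segment ℝ a t ⊆ Metric.ball a δ := (convex_ball a δ).segment_subset ha ht
  have hle : ∀ u ∈ segment ℝ a t, |u - a| ≤ |t - a| := by
    intro u hu
    rw [segment_eq_uIcc] at hu
    exact Set.abs_sub_left_of_mem_uIcc hu
  have := (convex_segment a t).norm_image_sub_le_of_norm_hasDerivWithin_le (f := h) (f' := h')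
    (C := C * |t - a| ^ k) (fun u hu => (hd u (hseg hu)).hasDerivWithinAt)
    (fun u hu => (hb u (hseg hu)).trans
      (mul_le_mul_of_nonneg_left (pow_le_pow_left₀ (abs_nonneg _) (hle u hu) k) hC))
    (left_mem_segment ℝ a t) (right_mem_segment ℝ a t)
  rw [h0, sub_zero, Real.norm_eq_abs, Real.norm_eq_abs] at this
  rwa [pow_succ, ← mul_assoc]

lemma taylor_first_order (hC : 0 ≤ C) {g : ℕ → ℝ → ℝ}
    (hd : ∀ k < 2, ∀ t ∈ Metric.ball a δ, HasDerivAt (g k) (g (k + 1) t) t)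
    (hb : ∀ t ∈ Metric.ball a δ, |g 2 t| ≤ C) {t : ℝ} (ht : t ∈ Metric.ball a δ) :
    |g 0 t - (g 0 a + g 1 a * (t - a))| ≤ C * |t - a| ^ 2 := by
  have h1 : ∀ t ∈ Metric.ball a δ, |g 1 t - g 1 a| ≤ C * |t - a| ^ 1 := fun t ht =>
    abs_le_pow_succ_of_hasDerivAt (h := fun t => g 1 t - g 1 a) hC (sub_self _)
      (fun u hu => (hd 1 (by norm_num) u hu).sub_const _) (by simpa using hb) ht
  refine abs_le_pow_succ_of_hasDerivAt (h := fun t => g 0 t - (g 0 a + g 1 a * (t - a)))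
    (h' := fun t => g 1 t - g 1 a) hC (by simp) (fun u hu => ?_) h1 ht
  have hlin : HasDerivAt (fun t => g 0 a + g 1 a * (t - a)) (g 1 a) u := by
    simpa using (((hasDerivAt_id u).sub_const a).const_mul (g 1 a)).const_add (g 0 a)
  exact (hd 0 (by norm_num) u hu).sub hlin

lemma taylor_third_order (hC : 0 ≤ C) {g : ℕ → ℝ → ℝ}
    (hd : ∀ k < 4, ∀ t ∈ Metric.ball a δ, HasDerivAt (g k) (g (k + 1) t) t)
    (hb : ∀ t ∈ Metric.ball a δ, |g 4 t| ≤ C) {t : ℝ} (ht : t ∈ Metric.ball a δ) :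
    |g 0 t - (g 0 a + g 1 a * (t - a) + g 2 a * ((t - a) ^ 2 / 2) + g 3 a * ((t - a) ^ 3 / 6))|
      ≤ C * |t - a| ^ 4 := by
  have h2 : ∀ t ∈ Metric.ball a δ, |g 2 t - (g 2 a + g 3 a * (t - a))| ≤ C * |t - a| ^ 2 :=
    fun t ht => taylor_first_order (g := fun k => g (k + 2)) hC
      (fun k hk => hd (k + 2) (by omega)) hb ht
  have hid : ∀ u : ℝ, HasDerivAt (fun t => t - a) 1 u := fun u => (hasDerivAt_id u).sub_const a
  have hsq : ∀ u, HasDerivAt (fun t : ℝ => (t - a) ^ 2 / 2) (u - a) u := fun u => by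
    refine (((hid u).pow 2).div_const 2).congr_deriv ?_
    push_cast; ring
  have hcu : ∀ u, HasDerivAt (fun t : ℝ => (t - a) ^ 3 / 6) ((u - a) ^ 2 / 2) u := fun u => by
    refine (((hid u).pow 3).div_const 6).congr_deriv ?_
    push_cast; ring
  have h1 : ∀ t ∈ Metric.ball a δ,
      |g 1 t - (g 1 a + g 2 a * (t - a) + g 3 a * ((t - a) ^ 2 / 2))| ≤ C * |t - a| ^ 3 := by
    intro t ht
    refine abs_le_pow_succ_of_hasDerivAt
      (h := fun t => g 1 t - (g 1 a + g 2 a * (t - a) + g 3 a * ((t - a) ^ 2 / 2)))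
      (h' := fun t => g 2 t - (g 2 a + g 3 a * (t - a))) hC (by simp) (fun u hu => ?_) h2 ht
    have := (((hid u).const_mul (g 2 a)).const_add (g 1 a)).add ((hsq u).const_mul (g 3 a))
    rw [mul_one] at this
    exact (hd 1 (by norm_num) u hu).sub this
  refine abs_le_pow_succ_of_hasDerivAt
    (h := fun t => g 0 t - (g 0 a + g 1 a * (t - a) + g 2 a * ((t - a) ^ 2 / 2)
      + g 3 a * ((t - a) ^ 3 / 6)))
    (h' := fun t => g 1 t - (g 1 a + g 2 a * (t - a) + g 3 a * ((t - a) ^ 2 / 2)))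
    hC (by simp) (fun u hu => ?_) h1 ht
  have := ((((hid u).const_mul (g 1 a)).const_add (g 0 a)).add ((hsq u).const_mul (g 2 a))).add
    ((hcu u).const_mul (g 3 a))
  rw [mul_one] at this
  exact (hd 0 (by norm_num) u hu).sub this

end Taylor

/-! ### The parametric family -/

/-- The vector `∂m/∂θ`, written out in terms of the derivatives of the log density. -/
noncomputable def mDer1 {𝒵 : Type*} (f : 𝒵 → ℝ → ℝ) (Θ : Set ℝ) (z : 𝒵) (θ : ℝ) : Fin 3 → ℝ :=
  ![-dlog f Θ 3 z θ, dlog f Θ 4 z θ,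
    dlog f Θ 2 z θ * dlog f Θ 2 z θ + dlog f Θ 1 z θ * dlog f Θ 3 z θ]

/-- The vector `∂²m/∂θ²`, written out in terms of the derivatives of the log density. -/
noncomputable def mDer2 {𝒵 : Type*} (f : 𝒵 → ℝ → ℝ) (Θ : Set ℝ) (z : 𝒵) (θ : ℝ) : Fin 3 → ℝ :=
  ![-dlog f Θ 4 z θ, dlog f Θ 5 z θ,
    3 * (dlog f Θ 2 z θ * dlog f Θ 3 z θ) + dlog f Θ 1 z θ * dlog f Θ 4 z θ]

section Pointwise

variable {𝒵 : Type*} {f : 𝒵 → ℝ → ℝ} {Θ : Set ℝ}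

lemma dlog_zero (z : 𝒵) (θ : ℝ) : dlog f Θ 0 z θ = Real.log (f z θ) := by
  simp [dlog]

lemma abs_m_le {M : 𝒵 → ℝ} (hM0 : ∀ z, 0 ≤ M z)
    (hM : ∀ z, ∀ θ ∈ Θ, ∀ k ≤ 7, |dlog f Θ k z θ| ≤ M z) (z : 𝒵) {θ : ℝ} (hθ : θ ∈ Θ)
    (j : Fin 3) : |m f Θ z θ j| ≤ M z + M z ^ 2 := by
  have hd := hM z θ hθ
  have h0 := hM0 z
  have hmul : ∀ k ≤ 7, ∀ l ≤ 7, |dlog f Θ k z θ * dlog f Θ l z θ| ≤ M z ^ 2 :=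
    fun k hk l hl => by
      rw [abs_mul, sq]
      exact mul_le_mul (hd k hk) (hd l hl) (abs_nonneg _) h0
  fin_cases j
  · simpa [m] using (hd 2 (by norm_num)).trans (le_add_of_nonneg_right (sq_nonneg _))
  · simpa [m] using (hd 3 (by norm_num)).trans (le_add_of_nonneg_right (sq_nonneg _))
  · simpa [m] using (hmul 1 (by norm_num) 2 (by norm_num)).trans (le_add_of_nonneg_left h0)

lemma abs_mDer1_le {M : 𝒵 → ℝ} (hM0 : ∀ z, 0 ≤ M z)
    (hM : ∀ z, ∀ θ ∈ Θ, ∀ k ≤ 7, |dlog f Θ k z θ| ≤ M z) (z : 𝒵) {θ : ℝ} (hθ : θ ∈ Θ)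
    (j : Fin 3) : |mDer1 f Θ z θ j| ≤ M z + 2 * M z ^ 2 := by
  have hd := hM z θ hθ
  have h0 := hM0 z
  have hmul : ∀ k ≤ 7, ∀ l ≤ 7, |dlog f Θ k z θ * dlog f Θ l z θ| ≤ M z ^ 2 :=
    fun k hk l hl => by
      rw [abs_mul, sq]
      exact mul_le_mul (hd k hk) (hd l hl) (abs_nonneg _) h0
  fin_cases j
  · simpa [mDer1] using (hd 3 (by norm_num)).trans (le_add_of_nonneg_right (by positivity))
  · simpa [mDer1] using (hd 4 (by norm_num)).trans (le_add_of_nonneg_right (by positivity))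
  · simp only [mDer1, Fin.reduceFinMk, Matrix.cons_val]
    refine (abs_add_le _ _).trans ?_
    linarith [hmul 2 (by norm_num) 2 (by norm_num), hmul 1 (by norm_num) 3 (by norm_num)]

lemma abs_mDer2_le {M : 𝒵 → ℝ} (hM0 : ∀ z, 0 ≤ M z)
    (hM : ∀ z, ∀ θ ∈ Θ, ∀ k ≤ 7, |dlog f Θ k z θ| ≤ M z) (z : 𝒵) {θ : ℝ} (hθ : θ ∈ Θ)
    (j : Fin 3) : |mDer2 f Θ z θ j| ≤ M z + 4 * M z ^ 2 := by
  have hd := hM z θ hθ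
  have h0 := hM0 z
  have hmul : ∀ k ≤ 7, ∀ l ≤ 7, |dlog f Θ k z θ * dlog f Θ l z θ| ≤ M z ^ 2 :=
    fun k hk l hl => by
      rw [abs_mul, sq]
      exact mul_le_mul (hd k hk) (hd l hl) (abs_nonneg _) h0
  fin_cases j
  · simpa [mDer2] using (hd 4 (by norm_num)).trans (le_add_of_nonneg_right (by positivity))
  · simpa [mDer2] using (hd 5 (by norm_num)).trans (le_add_of_nonneg_right (by positivity))
  · simp only [mDer2, Fin.reduceFinMk, Matrix.cons_val]
    refine (abs_add_le _ _).trans ?_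
    rw [abs_mul 3, abs_of_pos (by norm_num : (0 : ℝ) < 3)]
    linarith [hmul 2 (by norm_num) 3 (by norm_num), hmul 1 (by norm_num) 4 (by norm_num)]

end Pointwise

namespace Regular

variable {𝒵 : Type*} [MeasurableSpace 𝒵] {ν : Measure 𝒵} {f : 𝒵 → ℝ → ℝ} {Θ : Set ℝ} {θ₀ : ℝ}

lemma mem (h : Regular ν f Θ θ₀) : θ₀ ∈ Θ := interior_subset h.mem_interior

/-- At interior points of `Θ` the derivatives within `Θ` are ordinary derivatives. -/
lemma hasDerivAt_dlog (h : Regular ν f Θ θ₀) (z : 𝒵) {θ : ℝ} (hθ : θ ∈ interior Θ) {k : ℕ}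
    (hk : k < 7) : HasDerivAt (dlog f Θ k z) (dlog f Θ (k + 1) z θ) θ := by
  set g : ℝ → ℝ := fun t => Real.log (f z t) with hg
  have hev : ∀ t ∈ interior Θ, interior Θ =ᶠ[𝓝 t] Θ := fun t ht => by
    filter_upwards [isOpen_interior.mem_nhds ht] with u hu
    exact propext ⟨fun _ => interior_subset hu, fun _ => hu⟩
  have hcongr : ∀ t ∈ interior Θ, iteratedDerivWithin k g (interior Θ) t = dlog f Θ k z t :=
    fun t ht => by
      rw [dlog, iteratedDerivWithin, iteratedDerivWithin,
        iteratedFDerivWithin_congr_set (hev t ht)]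
  have hdiff : DifferentiableAt ℝ (dlog f Θ k z) θ := by
    have h1 := ((h.smooth z).mono interior_subset).differentiableOn_iteratedDerivWithin
      (m := k) (by exact_mod_cast hk) isOpen_interior.uniqueDiffOn
    refine ((h1 θ hθ).differentiableAt (isOpen_interior.mem_nhds hθ)).congr_of_eventuallyEq ?_
    filter_upwards [isOpen_interior.mem_nhds hθ] with t ht
    exact (hcongr t ht).symm
  have h2 : dlog f Θ (k + 1) z θ = deriv (dlog f Θ k z) θ := by
    rw [← derivWithin_of_mem_nhds (mem_interior_iff_mem_nhds.1 hθ)]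
    simp only [dlog, iteratedDerivWithin_succ]
    rfl
  rw [h2]
  exact hdiff.hasDerivAt

lemma hasDerivAt_density (h : Regular ν f Θ θ₀) (z : 𝒵) {θ : ℝ} (hθ : θ ∈ interior Θ) :
    HasDerivAt (f z) (dlog f Θ 1 z θ * f z θ) θ := by
  have h1 := (h.hasDerivAt_dlog z hθ (k := 0) (by norm_num)).exp
  have hexp : ∀ t ∈ Θ, Real.exp (dlog f Θ 0 z t) = f z t := fun t ht => by
    rw [dlog_zero, Real.exp_log (h.pos z t ht)]
  rw [hexp θ (interior_subset hθ), mul_comm] at h1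
  refine h1.congr_of_eventuallyEq ?_
  filter_upwards [isOpen_interior.mem_nhds hθ] with t ht
  exact (hexp t (interior_subset ht)).symm

lemma measurable_density (h : Regular ν f Θ θ₀) {θ : ℝ} (hθ : θ ∈ Θ) :
    Measurable (fun z => f z θ) := by
  have heq : (fun z => f z θ) = fun z => Real.exp (dlog f Θ 0 z θ) := by
    ext z
    rw [dlog_zero, Real.exp_log (h.pos z θ hθ)]
  rw [heq]
  exact (h.measurable θ hθ 0 (by norm_num)).exp

lemma integrable_density (h : Regular ν f Θ θ₀) {θ : ℝ} (hθ : θ ∈ Θ) :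
    Integrable (fun z => f z θ) ν := by
  by_contra hcon
  have := h.density θ hθ
  rw [integral_undef hcon] at this
  exact zero_ne_one this

lemma isProbabilityMeasure_law (h : Regular ν f Θ θ₀) : IsProbabilityMeasure (law ν f θ₀) := by
  refine ⟨?_⟩
  rw [law, withDensity_apply _ MeasurableSet.univ, Measure.restrict_univ,
    ← ofReal_integral_eq_lintegral_ofReal (h.integrable_density h.mem)
      (Eventually.of_forall fun z => (h.pos z θ₀ h.mem).le), h.density θ₀ h.mem,
    ENNReal.ofReal_one]

lemma integral_law (h : Regular ν f Θ θ₀) (g : 𝒵 → ℝ) :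
    ∫ z, g z ∂(law ν f θ₀) = ∫ z, g z * f z θ₀ ∂ν := by
  have hm : Measurable (fun z => (f z θ₀).toNNReal) := (h.measurable_density h.mem).real_toNNReal
  refine (integral_withDensity_eq_integral_smul hm g).trans ?_
  refine integral_congr_ae (Eventually.of_forall fun z => ?_)
  simp only [NNReal.smul_def, Real.coe_toNNReal _ (h.pos z θ₀ h.mem).le, smul_eq_mul, mul_comm]

lemma integrable_law_iff (h : Regular ν f Θ θ₀) (g : 𝒵 → ℝ) :
    Integrable g (law ν f θ₀) ↔ Integrable (fun z => g z * f z θ₀) ν := by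
  have hm : Measurable (fun z => (f z θ₀).toNNReal) := (h.measurable_density h.mem).real_toNNReal
  refine (integrable_withDensity_iff_integrable_smul hm).trans ?_
  refine integrable_congr (Eventually.of_forall fun z => ?_)
  simp only [NNReal.smul_def, Real.coe_toNNReal _ (h.pos z θ₀ h.mem).le, smul_eq_mul, mul_comm]

/-- The envelope in the form used below: nonnegative, and with integrable powers up to the
sixteenth, as `Q > 16` and the law is a probability measure. -/
lemma exists_envelope (h : Regular ν f Θ θ₀) : ∃ M : 𝒵 → ℝ, (∀ z, 0 ≤ M z) ∧
    (∀ z, ∀ θ ∈ Θ, ∀ k ≤ 7, |dlog f Θ k z θ| ≤ M z) ∧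
    ∀ p ≤ 16, Integrable (fun z => M z ^ p) (law ν f θ₀) := by
  obtain ⟨M, Q, hQ, hM, hb⟩ := h.envelope
  have hM0 : ∀ z, 0 ≤ M z := fun z => (abs_nonneg _).trans (hb z θ₀ h.mem 0 (by norm_num))
  refine ⟨M, hM0, hb, fun p hp => ?_⟩
  have := h.isProbabilityMeasure_law
  -- `M` is recovered from its `Q`-th power, hence inherits measurability from integrability
  have hroot : ∀ z, (M z ^ Q) ^ (Q⁻¹) = M z := fun z => by
    rw [← Real.rpow_mul (hM0 z), mul_inv_cancel₀ (by linarith), Real.rpow_one]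
  have hmeas : AEStronglyMeasurable M (law ν f θ₀) := by
    have := (hM.aestronglyMeasurable.aemeasurable.pow_const Q⁻¹).aestronglyMeasurable
    simpa only [hroot] using this
  refine ((integrable_const (1 : ℝ)).add hM).mono' (hmeas.pow p)
    (Eventually.of_forall fun z => ?_)
  rw [Real.norm_of_nonneg (pow_nonneg (hM0 z) p)]
  simp only [Pi.add_apply]
  rcases le_total (M z) 1 with h1 | h1
  · exact (pow_le_one₀ (hM0 z) h1).trans (le_add_of_nonneg_right (Real.rpow_nonneg (hM0 z) Q))
  · have h2 : M z ^ p ≤ M z ^ Q := by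
      rw [← Real.rpow_natCast]
      refine Real.rpow_le_rpow_of_exponent_le h1 ?_
      have : (p : ℝ) ≤ 16 := by exact_mod_cast hp
      linarith
    linarith

lemma measurable_dlog (h : Regular ν f Θ θ₀) {k : ℕ} (hk : k ≤ 7) :
    Measurable (fun z => dlog f Θ k z θ₀) := h.measurable θ₀ h.mem k hk

lemma measurable_m (h : Regular ν f Θ θ₀) {θ : ℝ} (hθ : θ ∈ Θ) (j : Fin 3) :
    Measurable (fun z => m f Θ z θ j) := by
  have hd : ∀ k ≤ 7, Measurable (fun z => dlog f Θ k z θ) := h.measurable θ hθ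
  fin_cases j
  · exact (hd 2 (by norm_num)).neg
  · exact hd 3 (by norm_num)
  · exact (hd 1 (by norm_num)).mul (hd 2 (by norm_num))

lemma measurable_mDer1 (h : Regular ν f Θ θ₀) (j : Fin 3) :
    Measurable (fun z => mDer1 f Θ z θ₀ j) := by
  have hd : ∀ k ≤ 7, Measurable (fun z => dlog f Θ k z θ₀) := h.measurable θ₀ h.mem
  fin_cases j
  · exact (hd 3 (by norm_num)).neg
  · exact hd 4 (by norm_num)
  · exact ((hd 2 (by norm_num)).mul (hd 2 (by norm_num))).add
      ((hd 1 (by norm_num)).mul (hd 3 (by norm_num)))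

lemma hasDerivAt_m (h : Regular ν f Θ θ₀) (z : 𝒵) {θ : ℝ} (hθ : θ ∈ interior Θ) (j : Fin 3) :
    HasDerivAt (fun t => m f Θ z t j) (mDer1 f Θ z θ j) θ := by
  fin_cases j
  · exact (h.hasDerivAt_dlog z hθ (k := 2) (by norm_num)).neg
  · exact h.hasDerivAt_dlog z hθ (k := 3) (by norm_num)
  · exact (h.hasDerivAt_dlog z hθ (k := 1) (by norm_num)).mul
      (h.hasDerivAt_dlog z hθ (k := 2) (by norm_num))

lemma hasDerivAt_mDer1 (h : Regular ν f Θ θ₀) (z : 𝒵) {θ : ℝ} (hθ : θ ∈ interior Θ)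
    (j : Fin 3) : HasDerivAt (fun t => mDer1 f Θ z t j) (mDer2 f Θ z θ j) θ := by
  have hd := fun k (hk : k < 7) => h.hasDerivAt_dlog z hθ hk
  fin_cases j
  · exact (hd 3 (by norm_num)).neg
  · exact hd 4 (by norm_num)
  · have := ((hd 2 (by norm_num)).mul (hd 2 (by norm_num))).add
      ((hd 1 (by norm_num)).mul (hd 3 (by norm_num)))
    refine this.congr_deriv ?_
    simp only [mDer2, Fin.reduceFinMk, Matrix.cons_val]
    ring

/-- Functions dominated by `M + 4 M²` are square integrable, since `M` has sixteen moments. -/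
lemma memLp_two_of_abs_le {M φ : 𝒵 → ℝ}
    (hMi : ∀ p ≤ 16, Integrable (fun z => M z ^ p) (law ν f θ₀)) (hφm : Measurable φ)
    (hφ : ∀ z, |φ z| ≤ M z + 4 * M z ^ 2) : MemLp φ 2 (law ν f θ₀) := by
  rw [memLp_two_iff_integrable_sq hφm.aestronglyMeasurable]
  refine (((hMi 2 (by norm_num)).const_mul 2).add ((hMi 4 (by norm_num)).const_mul 32)).mono'
    (hφm.pow_const 2).aestronglyMeasurable (Eventually.of_forall fun z => ?_)
  rw [Real.norm_of_nonneg (sq_nonneg _), ← sq_abs]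
  have h1 : |φ z| ^ 2 ≤ (M z + 4 * M z ^ 2) ^ 2 := by
    gcongr
    exact hφ z
  simp only [Pi.add_apply]
  nlinarith [sq_nonneg (M z - 4 * M z ^ 2)]

lemma memLp_dlog (h : Regular ν f Θ θ₀) {k : ℕ} (hk : k ≤ 7) :
    MemLp (fun z => dlog f Θ k z θ₀) 2 (law ν f θ₀) := by
  obtain ⟨M, hM0, hM, hMi⟩ := h.exists_envelope
  exact memLp_two_of_abs_le hMi (h.measurable_dlog hk) fun z =>
    (hM z θ₀ h.mem k hk).trans (le_add_of_nonneg_right (by positivity))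

lemma memLp_m (h : Regular ν f Θ θ₀) (j : Fin 3) :
    MemLp (fun z => m f Θ z θ₀ j) 2 (law ν f θ₀) := by
  obtain ⟨M, hM0, hM, hMi⟩ := h.exists_envelope
  exact memLp_two_of_abs_le hMi (h.measurable_m h.mem j) fun z =>
    (abs_m_le hM0 hM z h.mem j).trans (by nlinarith [sq_nonneg (M z)])

lemma memLp_mDer1 (h : Regular ν f Θ θ₀) (j : Fin 3) :
    MemLp (fun z => mDer1 f Θ z θ₀ j) 2 (law ν f θ₀) := by
  obtain ⟨M, hM0, hM, hMi⟩ := h.exists_envelope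
  exact memLp_two_of_abs_le hMi (h.measurable_mDer1 j) fun z =>
    (abs_mDer1_le hM0 hM z h.mem j).trans (by nlinarith [sq_nonneg (M z)])

lemma mDeriv_eq (h : Regular ν f Θ θ₀) (j : Fin 3) :
    mDeriv ν f Θ θ₀ j = ∫ z, mDer1 f Θ z θ₀ j ∂(law ν f θ₀) := by
  refine integral_congr_ae (Eventually.of_forall fun z => ?_)
  exact (derivWithin_of_mem_nhds (mem_interior_iff_mem_nhds.1 h.mem_interior)).trans
    (h.hasDerivAt_m z h.mem_interior j).deriv

end Regular

/-! ### Information identities and the derivative of the bias function -/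

lemma differentiableAt_tau {t : Fin 3 → ℝ} (ht : t 0 ≠ 0) : DifferentiableAt ℝ tau t := by
  have h1 : DifferentiableAt ℝ (fun t : Fin 3 → ℝ => (t 0 ^ 2)⁻¹) t :=
    DifferentiableAt.fun_inv (by fun_prop) (pow_ne_zero 2 ht)
  have h2 : tau = fun t => (1 / 2 * t 1 + t 2) * (t 0 ^ 2)⁻¹ := by
    ext t
    rw [tau, div_eq_mul_inv, div_eq_mul_inv, mul_inv]
    ring
  rw [h2]
  fun_prop

namespace Regular

variable {𝒵 : Type*} [MeasurableSpace 𝒵] {ν : Measure 𝒵} {f : 𝒵 → ℝ → ℝ} {Θ : Set ℝ} {θ₀ : ℝ}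

lemma hasDerivAt_score_mul_density (h : Regular ν f Θ θ₀) (z : 𝒵) {θ : ℝ}
    (hθ : θ ∈ interior Θ) :
    HasDerivAt (fun t => dlog f Θ 1 z t * f z t)
      ((dlog f Θ 2 z θ + dlog f Θ 1 z θ ^ 2) * f z θ) θ := by
  refine ((h.hasDerivAt_dlog z hθ (k := 1) (by norm_num)).mul
    (h.hasDerivAt_density z hθ)).congr_deriv ?_
  ring

lemma hasDerivAt_m_mul_density (h : Regular ν f Θ θ₀) (z : 𝒵) {θ : ℝ} (hθ : θ ∈ interior Θ)
    (j : Fin 3) : HasDerivAt (fun t => m f Θ z t j * f z t)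
      ((mDer1 f Θ z θ j + m f Θ z θ j * dlog f Θ 1 z θ) * f z θ) θ := by
  refine ((h.hasDerivAt_m z hθ j).mul (h.hasDerivAt_density z hθ)).congr_deriv ?_
  ring

/-- The domination hypothesis in terms of the derivatives of the log density, on a ball around
`θ₀` inside `Θ`. -/
lemma exists_dominating (h : Regular ν f Θ θ₀) : ∃ G : 𝒵 → ℝ, Integrable G ν ∧ ∃ r > 0,
    Metric.ball θ₀ r ⊆ interior Θ ∧ ∀ θ ∈ Metric.ball θ₀ r, ∀ z,
      |dlog f Θ 1 z θ * f z θ| ≤ G z ∧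
      |(dlog f Θ 2 z θ + dlog f Θ 1 z θ ^ 2) * f z θ| ≤ G z ∧
      ∀ j, |(mDer1 f Θ z θ j + m f Θ z θ j * dlog f Θ 1 z θ) * f z θ| ≤ G z := by
  obtain ⟨G, hG, hev⟩ := h.dominated
  obtain ⟨r, hr, hball⟩ := Metric.eventually_nhds_iff_ball.1
    (hev.and (isOpen_interior.mem_nhds h.mem_interior))
  refine ⟨G, hG, r, hr, fun θ hθ => (hball θ hθ).2, fun θ hθ z => ?_⟩
  have hint := (hball θ hθ).2
  have hder : ∀ {g : ℝ → ℝ} {g' t : ℝ}, t ∈ interior Θ → HasDerivAt g g' t →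
      derivWithin g Θ t = g' := fun ht hg => by
    rw [derivWithin_of_mem_nhds (mem_interior_iff_mem_nhds.1 ht), hg.deriv]
  have h1 : ∀ t ∈ interior Θ, iteratedDerivWithin 1 (f z) Θ t = dlog f Θ 1 z t * f z t :=
    fun t ht => by rw [iteratedDerivWithin_one, hder ht (h.hasDerivAt_density z ht)]
  have h2 : iteratedDerivWithin 2 (f z) Θ θ =
      (dlog f Θ 2 z θ + dlog f Θ 1 z θ ^ 2) * f z θ := by
    rw [iteratedDerivWithin_succ]
    refine hder hint ((h.hasDerivAt_score_mul_density z hint).congr_of_eventuallyEq ?_)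
    filter_upwards [isOpen_interior.mem_nhds hint] with t ht using h1 t ht
  obtain ⟨b1, b2, b3⟩ := (hball θ hθ).1 z
  rw [h1 θ hint] at b1
  rw [h2] at b2
  refine ⟨b1, b2, fun j => ?_⟩
  have := b3 j
  rwa [hder hint (h.hasDerivAt_m_mul_density z hint j)] at this

lemma measurable_score_mul_density (h : Regular ν f Θ θ₀) {θ : ℝ} (hθ : θ ∈ Θ) :
    Measurable (fun z => dlog f Θ 1 z θ * f z θ) :=
  (h.measurable θ hθ 1 (by norm_num)).mul (h.measurable_density hθ)

lemma integral_score_mul_density (h : Regular ν f Θ θ₀) : ∃ r > 0,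
    ∀ θ ∈ Metric.ball θ₀ r, ∫ z, dlog f Θ 1 z θ * f z θ ∂ν = 0 := by
  obtain ⟨G, hG, r, hr, hsub, hb⟩ := h.exists_dominating
  refine ⟨r, hr, fun θ hθ => ?_⟩
  have hmemΘ : ∀ᶠ t in 𝓝 θ, t ∈ Θ :=
    (Metric.isOpen_ball.mem_nhds hθ : _) |> fun hn => mem_of_superset hn
      fun t ht => interior_subset (hsub ht)
  have hd := (hasDerivAt_integral_of_dominated_loc_of_deriv_le (μ := ν)
    (F := fun t z => f z t) (F' := fun t z => dlog f Θ 1 z t * f z t) (bound := G)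
    (Metric.isOpen_ball.mem_nhds hθ)
    (hmemΘ.mono fun t ht => (h.measurable_density ht).aestronglyMeasurable)
    (h.integrable_density hmemΘ.self_of_nhds)
    (h.measurable_score_mul_density hmemΘ.self_of_nhds).aestronglyMeasurable
    (Eventually.of_forall fun z t ht => (hb t ht z).1) hG
    (Eventually.of_forall fun z t ht => h.hasDerivAt_density z (hsub ht))).2
  have hc : HasDerivAt (fun t => ∫ z, f z t ∂ν) 0 θ :=
    (hasDerivAt_const θ (1 : ℝ)).congr_of_eventuallyEq (hmemΘ.mono fun t ht => h.density t ht)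
  exact hd.unique hc

/-- The score has mean zero. -/
lemma integral_score (h : Regular ν f Θ θ₀) : ∫ z, dlog f Θ 1 z θ₀ ∂(law ν f θ₀) = 0 := by
  obtain ⟨r, hr, hz⟩ := h.integral_score_mul_density
  rw [h.integral_law]
  exact hz θ₀ (Metric.mem_ball_self hr)

/-- The information identity `E[ℓ²] = -E[ℓ^θ]`. -/
lemma integral_score_sq (h : Regular ν f Θ θ₀) :
    ∫ z, dlog f Θ 1 z θ₀ * dlog f Θ 1 z θ₀ ∂(law ν f θ₀) = info ν f Θ θ₀ := by
  obtain ⟨G, hG, r, hr, hsub, hb⟩ := h.exists_dominating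
  obtain ⟨r', hr', hz⟩ := h.integral_score_mul_density
  have hprob := h.isProbabilityMeasure_law
  have hΘ : ∀ᶠ t in 𝓝 θ₀, t ∈ Θ := mem_interior_iff_mem_nhds.1 h.mem_interior
  have hd1 : ∀ k ≤ 7, Measurable (fun z => dlog f Θ k z θ₀) := h.measurable θ₀ h.mem
  have hd := (hasDerivAt_integral_of_dominated_loc_of_deriv_le (μ := ν)
    (F := fun t z => dlog f Θ 1 z t * f z t)
    (F' := fun t z => (dlog f Θ 2 z t + dlog f Θ 1 z t ^ 2) * f z t) (bound := G)
    (Metric.ball_mem_nhds θ₀ hr)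
    (hΘ.mono fun t ht => (h.measurable_score_mul_density ht).aestronglyMeasurable)
    ((h.integrable_law_iff _).1 ((h.memLp_dlog (k := 1) (by norm_num)).integrable (by norm_num)))
    (((hd1 2 (by norm_num)).add ((hd1 1 (by norm_num)).pow_const 2)).mul
      (h.measurable_density h.mem)).aestronglyMeasurable
    (Eventually.of_forall fun z t ht => (hb t ht z).2.1) hG
    (Eventually.of_forall fun z t ht => h.hasDerivAt_score_mul_density z (hsub ht))).2
  have hc : HasDerivAt (fun t => ∫ z, dlog f Θ 1 z t * f z t ∂ν) 0 θ₀ :=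
    (hasDerivAt_const θ₀ (0 : ℝ)).congr_of_eventuallyEq
      (mem_of_superset (Metric.ball_mem_nhds θ₀ hr') hz)
  have h0 := hd.unique hc
  rw [← h.integral_law (fun z => dlog f Θ 2 z θ₀ + dlog f Θ 1 z θ₀ ^ 2),
    integral_add ((h.memLp_dlog (k := 2) (by norm_num)).integrable (by norm_num))
      (h.memLp_dlog (k := 1) (by norm_num)).integrable_sq] at h0
  simp only [← sq]
  rw [info, meanDlog]
  linarith

lemma mBar_zero : mBar ν f Θ θ₀ 0 = info ν f Θ θ₀ := by
  simp only [mBar, info, meanDlog, m, Matrix.cons_val_zero]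
  exact integral_neg _

lemma hasFDerivAt_tau (h : Regular ν f Θ θ₀) :
    HasFDerivAt tau (tauM ν f Θ θ₀) (mBar ν f Θ θ₀) :=
  (differentiableAt_tau (by rw [mBar_zero]; exact h.info_pos.ne')).hasFDerivAt

lemma bias_eq_tau_mBar (h : Regular ν f Θ θ₀) : bias ν f Θ θ₀ = tau (mBar ν f Θ θ₀) := by
  unfold bias mBar
  simp only [h.integral_law]

/-- `∂/∂θ ∫ m f dν = M + Λ` at `θ₀`: the derivative falls on `m` and on the density. -/
lemma hasDerivAt_integral_m (h : Regular ν f Θ θ₀) :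
    HasDerivAt (fun θ => (fun j => ∫ z, m f Θ z θ j * f z θ ∂ν : Fin 3 → ℝ))
      (mDeriv ν f Θ θ₀ + mScore ν f Θ θ₀) θ₀ := by
  obtain ⟨G, hG, r, hr, hsub, hb⟩ := h.exists_dominating
  have hprob := h.isProbabilityMeasure_law
  have hΘ : ∀ᶠ t in 𝓝 θ₀, t ∈ Θ := mem_interior_iff_mem_nhds.1 h.mem_interior
  refine hasDerivAt_pi.2 fun j => ?_
  have hd := (hasDerivAt_integral_of_dominated_loc_of_deriv_le (μ := ν)
    (F := fun t z => m f Θ z t j * f z t)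
    (F' := fun t z => (mDer1 f Θ z t j + m f Θ z t j * dlog f Θ 1 z t) * f z t) (bound := G)
    (Metric.ball_mem_nhds θ₀ hr)
    (hΘ.mono fun t ht =>
      ((h.measurable_m ht j).mul (h.measurable_density ht)).aestronglyMeasurable)
    ((h.integrable_law_iff _).1 ((h.memLp_m j).integrable (by norm_num)))
    (((h.measurable_mDer1 j).add ((h.measurable_m h.mem j).mul
      (h.measurable_dlog (k := 1) (by norm_num)))).mul
      (h.measurable_density h.mem)).aestronglyMeasurable
    (Eventually.of_forall fun z t ht => (hb t ht z).2.2 j) hG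
    (Eventually.of_forall fun z t ht => h.hasDerivAt_m_mul_density z (hsub ht) j)).2
  have hint : Integrable (fun z => m f Θ z θ₀ j * dlog f Θ 1 z θ₀) (law ν f θ₀) :=
    (h.memLp_m j).integrable_mul (h.memLp_dlog (k := 1) (by norm_num))
  refine hd.congr_deriv ?_
  rw [← h.integral_law (fun z => mDer1 f Θ z θ₀ j + m f Θ z θ₀ j * dlog f Θ 1 z θ₀),
    integral_add ((h.memLp_mDer1 j).integrable (by norm_num)) hint, Pi.add_apply,
    h.mDeriv_eq]
  rfl

lemma hasDerivAt_bias (h : Regular ν f Θ θ₀) :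
    HasDerivAt (bias ν f Θ) (tauM ν f Θ θ₀ (mDeriv ν f Θ θ₀ + mScore ν f Θ θ₀)) θ₀ := by
  have h1 : (fun j => ∫ z, m f Θ z θ₀ j * f z θ₀ ∂ν : Fin 3 → ℝ) = mBar ν f Θ θ₀ := by
    unfold mBar
    simp only [h.integral_law]
  have h2 := h.hasFDerivAt_tau
  rw [← h1] at h2
  exact h2.comp_hasDerivAt θ₀ h.hasDerivAt_integral_m

lemma memLp_dlog_sub_mean (h : Regular ν f Θ θ₀) {k : ℕ} (hk : k ≤ 7) :
    MemLp (fun z => dlog f Θ k z θ₀ - meanDlog ν f Θ θ₀ k) 2 (law ν f θ₀) := by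
  have := h.isProbabilityMeasure_law
  exact (h.memLp_dlog hk).sub (memLp_const _)

lemma integral_dlog_sub_mean (h : Regular ν f Θ θ₀) {k : ℕ} (hk : k ≤ 7) :
    ∫ z, (dlog f Θ k z θ₀ - meanDlog ν f Θ θ₀ k) ∂(law ν f θ₀) = 0 := by
  have := h.isProbabilityMeasure_law
  rw [integral_sub ((h.memLp_dlog hk).integrable (by norm_num)) (integrable_const _)]
  simp [meanDlog]

/-! ### The second-order bias -/

section SecondOrderBias

variable {Ω : Type*} [MeasurableSpace Ω] {P : Measure Ω} [IsProbabilityMeasure P] {Z : ℕ → Ω → 𝒵}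

/-- `E[A₂] = b(θ₀)`: by the information identity `E[U²] = 𝓘`, while `E[U V] = E[ℓ ℓ^θ]`. -/
lemma integral_A2 (h : Regular ν f Θ θ₀) (hindep : iIndepFun Z P)
    (hlaw : ∀ i, HasLaw (Z i) (law ν f θ₀) P) {n : ℕ} (hn : 1 ≤ n) :
    Integrable (A2 ν f Θ θ₀ Z n) P ∧ ∫ ω, A2 ν f Θ θ₀ Z n ω ∂P = bias ν f Θ θ₀ := by
  have hprob := h.isProbabilityMeasure_law
  have hI := h.info_pos.ne'
  have hl := h.memLp_dlog (k := 1) (by norm_num)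
  have hl2 := h.memLp_dlog (k := 2) (by norm_num)
  have hv := h.memLp_dlog_sub_mean (k := 2) (by norm_num)
  set U : Ω → ℝ := normSum Z (fun z => dlog f Θ 1 z θ₀) n with hU
  set V : Ω → ℝ := centSum ν f Θ θ₀ Z 2 n with hV
  have hA : A2 ν f Θ θ₀ Z n = fun ω =>
      1 / 2 * (info ν f Θ θ₀)⁻¹ ^ 3 * meanDlog ν f Θ θ₀ 3 * (U ω * U ω) +
        (info ν f Θ θ₀)⁻¹ ^ 2 * (U ω * V ω) := by
    ext ω
    simp only [A2, hU, hV]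
    ring
  have hUU : Integrable (fun ω => U ω * U ω) P := integrable_normSum_mul_normSum hlaw hl hl n
  have hUV : Integrable (fun ω => U ω * V ω) P := integrable_normSum_mul_normSum hlaw hl hv n
  have hEUU : ∫ ω, U ω * U ω ∂P = info ν f Θ θ₀ :=
    (integral_normSum_mul_normSum hindep hlaw hl hl h.integral_score hn).trans h.integral_score_sq
  have hEUV : ∫ ω, U ω * V ω ∂P =
      ∫ z, dlog f Θ 1 z θ₀ * dlog f Θ 2 z θ₀ ∂(law ν f θ₀) := by
    refine (integral_normSum_mul_normSum hindep hlaw hl hv h.integral_score hn).trans ?_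
    have hint : Integrable (fun z => dlog f Θ 1 z θ₀ * dlog f Θ 2 z θ₀) (law ν f θ₀) :=
      hl.integrable_mul hl2
    simp only [mul_sub]
    rw [integral_sub hint ((hl.integrable (by norm_num)).mul_const _),
      integral_mul_const, h.integral_score, zero_mul, sub_zero]
  rw [hA]
  refine ⟨(hUU.const_mul _).add (hUV.const_mul _), ?_⟩
  rw [integral_add (hUU.const_mul _) (hUV.const_mul _), integral_const_mul, integral_const_mul,
    hEUU, hEUV, h.bias_eq_tau_mBar, tau, mBar_zero]
  simp only [mBar, m, Matrix.cons_val, meanDlog]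
  field_simp

end SecondOrderBias

end Regular

/-! ### Consistency of the maximum likelihood estimator -/

lemma eventually_isMaxOn {𝒵 Ω : Type*} [MeasurableSpace Ω] {P : Measure Ω} {f : 𝒵 → ℝ → ℝ}
    {Θ : Set ℝ} {Z : ℕ → Ω → 𝒵} {θhat : ℕ → Ω → ℝ} (hmle : IsMLE P f Θ Z θhat) :
    ∀ᶠ x in inProb P, θhat x.1 x.2 ∈ Θ ∧
      IsMaxOn (fun θ => avg Z (fun z => dlog f Θ 0 z θ) x.1 x.2) Θ (θhat x.1 x.2) := by
  refine eventually_inProb_of_ae fun n => ?_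
  simp only [dlog_zero]
  exact (hmle n).2

namespace Regular

variable {𝒵 : Type*} [MeasurableSpace 𝒵] {ν : Measure 𝒵} {f : 𝒵 → ℝ → ℝ} {Θ : Set ℝ} {θ₀ : ℝ}

lemma integrable_logDensity (h : Regular ν f Θ θ₀) {θ : ℝ} (hθ : θ ∈ Θ) :
    Integrable (fun z => dlog f Θ 0 z θ) (law ν f θ₀) := by
  obtain ⟨M, hM0, hM, hMi⟩ := h.exists_envelope
  have h1 := hMi 1 (by norm_num)
  simp only [pow_one] at h1
  exact h1.mono' (h.measurable θ hθ 0 (by norm_num)).aestronglyMeasurable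
    (Eventually.of_forall fun z => hM z θ hθ 0 (by norm_num))

/-- Positivity of the Kullback–Leibler divergence: the expected log density is uniquely maximized
at the true parameter. -/
lemma integral_logDensity_lt (h : Regular ν f Θ θ₀) {θ : ℝ} (hθ : θ ∈ Θ) (hne : θ ≠ θ₀) :
    ∫ z, dlog f Θ 0 z θ ∂(law ν f θ₀) < ∫ z, dlog f Θ 0 z θ₀ ∂(law ν f θ₀) := by
  have hprob := h.isProbabilityMeasure_law
  have hpos := fun z => h.pos z θ hθ
  have hpos₀ := fun z => h.pos z θ₀ h.mem
  by_contra! hcon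
  have hr : ∀ z, 0 < f z θ / f z θ₀ := fun z => div_pos (hpos z) (hpos₀ z)
  have hmul : ∀ z, f z θ / f z θ₀ * f z θ₀ = f z θ := fun z => div_mul_cancel₀ _ (hpos₀ z).ne'
  have hint : Integrable (fun z => f z θ / f z θ₀) (law ν f θ₀) := by
    rw [h.integrable_law_iff]
    simpa only [hmul] using h.integrable_density hθ
  have hone : ∫ z, f z θ / f z θ₀ ∂(law ν f θ₀) = 1 := by
    rw [h.integral_law]
    simpa only [hmul] using h.density θ hθ
  have hlog : ∀ z, Real.log (f z θ / f z θ₀) = dlog f Θ 0 z θ - dlog f Θ 0 z θ₀ := fun z => by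
    rw [dlog_zero, dlog_zero, Real.log_div (hpos z).ne' (hpos₀ z).ne']
  have hlint : Integrable (fun z => Real.log (f z θ / f z θ₀)) (law ν f θ₀) := by
    simp only [hlog]
    exact (h.integrable_logDensity hθ).sub (h.integrable_logDensity h.mem)
  have hsub : Integrable (fun z => f z θ / f z θ₀ - 1) (law ν f θ₀) :=
    hint.sub (integrable_const 1)
  have hdint : Integrable (fun z => f z θ / f z θ₀ - 1 - Real.log (f z θ / f z θ₀))
      (law ν f θ₀) := hsub.sub hlint
  have hnn : ∀ z, 0 ≤ f z θ / f z θ₀ - 1 - Real.log (f z θ / f z θ₀) := fun z =>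
    sub_nonneg.2 (Real.log_le_sub_one_of_pos (hr z))
  have hle : ∫ z, (f z θ / f z θ₀ - 1 - Real.log (f z θ / f z θ₀)) ∂(law ν f θ₀) ≤ 0 := by
    rw [integral_sub hsub hlint, integral_sub hint (integrable_const 1), hone]
    simp only [hlog]
    rw [integral_sub (h.integrable_logDensity hθ) (h.integrable_logDensity h.mem)]
    simp
    exact hcon
  have hzero := (integral_eq_zero_iff_of_nonneg hnn hdint).1
    (le_antisymm hle (integral_nonneg hnn))
  refine h.identified θ hθ hne ?_
  filter_upwards [hzero] with z hz
  by_contra hfz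
  have hne1 : f z θ / f z θ₀ ≠ 1 := fun h1 => hfz ((div_eq_one_iff_eq (hpos₀ z).ne').1 h1)
  have h1 := Real.log_lt_sub_one_of_pos (hr z) hne1
  have h2 : f z θ / f z θ₀ - 1 - Real.log (f z θ / f z θ₀) = 0 := hz
  linarith

/-- Wald's local bound: near `θ₁ ≠ θ₀` the log densities are dominated by a single measurable
function, the supremum over a countable dense set of parameters, whose mean is still smaller than
that of the log density at `θ₀`. -/
lemma exists_local_dominating (h : Regular ν f Θ θ₀) {θ₁ : ℝ} (hθ₁ : θ₁ ∈ Θ) (hne : θ₁ ≠ θ₀) :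
    ∃ δ > 0, ∃ g : 𝒵 → ℝ, MemLp g 2 (law ν f θ₀) ∧
      (∀ θ ∈ Θ ∩ Metric.ball θ₁ δ, ∀ z, dlog f Θ 0 z θ ≤ g z) ∧
      ∫ z, g z ∂(law ν f θ₀) < ∫ z, dlog f Θ 0 z θ₀ ∂(law ν f θ₀) := by
  obtain ⟨M, hM0, hM, hMi⟩ := h.exists_envelope
  let T : ℕ → Set ℝ := fun k => Θ ∩ Metric.ball θ₁ (1 / ((k : ℝ) + 1))
  have hT : ∀ k, θ₁ ∈ T k := fun k => ⟨hθ₁, Metric.mem_ball_self (by positivity)⟩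
  have hTne : ∀ k, Nonempty (T k) := fun k => ⟨⟨θ₁, hT k⟩⟩
  let S : ℕ → 𝒵 → ℝ := fun k z =>
    ⨆ i : ℕ, dlog f Θ 0 z (TopologicalSpace.denseSeq (T k) i : T k)
  have habs : ∀ k z (t : T k), |dlog f Θ 0 z t| ≤ M z := fun k z t => hM z t t.2.1 0 (by norm_num)
  have hbdd : ∀ k z, BddAbove (Set.range fun i : ℕ =>
      dlog f Θ 0 z (TopologicalSpace.denseSeq (T k) i : T k)) := fun k z =>
    ⟨M z, by rintro _ ⟨i, rfl⟩; exact (le_abs_self _).trans (habs k z _)⟩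
  have hcont : ∀ z, ContinuousOn (dlog f Θ 0 z) Θ := fun z => by
    have := (h.smooth z).continuousOn
    exact this.congr fun t _ => dlog_zero z t
  have hle : ∀ k z, ∀ t ∈ T k, dlog f Θ 0 z t ≤ S k z := by
    intro k z t ht
    refine (TopologicalSpace.denseRange_denseSeq (T k)).induction_on
      (p := fun t : T k => dlog f Θ 0 z t ≤ S k z) ⟨t, ht⟩ ?_ (fun i => le_ciSup (hbdd k z) i)
    refine isClosed_le ?_ continuous_const
    exact ((hcont z).mono Set.inter_subset_left).domRestrict
  have hSM : ∀ k z, |S k z| ≤ M z := fun k z => by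
    refine abs_le.2 ⟨(neg_le_of_abs_le (habs k z ⟨θ₁, hT k⟩)).trans (hle k z θ₁ (hT k)), ?_⟩
    exact ciSup_le fun i => (le_abs_self _).trans (habs k z _)
  have hSmeas : ∀ k, Measurable (S k) := fun k => Measurable.iSup fun i =>
    h.measurable _ (TopologicalSpace.denseSeq (T k) i).2.1 0 (by norm_num)
  have hlim : ∀ z, Tendsto (fun k => S k z) atTop (𝓝 (dlog f Θ 0 z θ₁)) := by
    intro z
    rw [Metric.tendsto_atTop]
    intro ε hε
    obtain ⟨δ, hδ, hδε⟩ := Metric.continuousWithinAt_iff.1 (hcont z θ₁ hθ₁) (ε / 2) (by linarith)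
    obtain ⟨N, hN⟩ := exists_nat_one_div_lt hδ
    refine ⟨N, fun k hk => ?_⟩
    have hup : S k z ≤ dlog f Θ 0 z θ₁ + ε / 2 := by
      refine ciSup_le fun i => ?_
      have hmem := (TopologicalSpace.denseSeq (T k) i).2
      have hd := hδε hmem.1 (lt_trans (Metric.mem_ball.1 hmem.2)
        ((one_div_le_one_div_of_le (by positivity) (by gcongr)).trans_lt hN))
      rw [Real.dist_eq] at hd
      linarith [(abs_lt.1 hd).2]
    have hlow := hle k z θ₁ (hT k)
    rw [Real.dist_eq, abs_of_nonneg (by linarith)]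
    linarith
  have hM1 := hMi 1 (by norm_num)
  simp only [pow_one] at hM1
  have hint := tendsto_integral_of_dominated_convergence M
    (fun k => (hSmeas k).aestronglyMeasurable) hM1
    (fun k => Eventually.of_forall (hSM k)) (Eventually.of_forall hlim)
  obtain ⟨k, hk⟩ := (hint.eventually_lt_const (h.integral_logDensity_lt hθ₁ hne)).exists
  refine ⟨1 / ((k : ℝ) + 1), by positivity, S k,
    memLp_two_of_abs_le hMi (hSmeas k) fun z => (hSM k z).trans
      (le_add_of_nonneg_right (by positivity)), fun θ hθ z => hle k z θ hθ, hk⟩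

variable {Ω : Type*} [MeasurableSpace Ω] {P : Measure Ω} [IsProbabilityMeasure P] {Z : ℕ → Ω → 𝒵}

/-- Away from `θ₀` the average log likelihood is, with probability tending to one, uniformly below
its value at `θ₀`. -/
lemma eventually_avg_logDensity_lt (h : Regular ν f Θ θ₀) (hindep : iIndepFun Z P)
    (hlaw : ∀ i, HasLaw (Z i) (law ν f θ₀) P) {ε : ℝ} (hε : 0 < ε) :
    ∀ᶠ x in inProb P, ∀ θ ∈ Θ \ Metric.ball θ₀ ε,
      avg Z (fun z => dlog f Θ 0 z θ) x.1 x.2 < avg Z (fun z => dlog f Θ 0 z θ₀) x.1 x.2 := by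
  have hK : IsCompact (Θ \ Metric.ball θ₀ ε) := h.compact.diff Metric.isOpen_ball
  have hne : ∀ θ ∈ Θ \ Metric.ball θ₀ ε, θ ≠ θ₀ := fun θ hθ heq =>
    hθ.2 (heq ▸ Metric.mem_ball_self hε)
  choose! δ hδ g hg hle hlt using
    fun θ (hθ : θ ∈ Θ \ Metric.ball θ₀ ε) => h.exists_local_dominating hθ.1 (hne θ hθ)
  obtain ⟨t, htK, hcov⟩ := hK.elim_nhds_subcover (fun θ => Metric.ball θ (δ θ))
    fun θ hθ => Metric.ball_mem_nhds θ (hδ θ hθ)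
  have hev : ∀ᶠ x in inProb P, ∀ θ₁ ∈ t,
      avg Z (g θ₁) x.1 x.2 < avg Z (fun z => dlog f Θ 0 z θ₀) x.1 x.2 :=
    (eventually_all_finset t).2 fun θ₁ hθ₁ =>
      (tendsto_avg_inProb hindep hlaw (hg θ₁ (htK θ₁ hθ₁))).eventually_lt
        (tendsto_avg_inProb hindep hlaw (h.memLp_dlog (Nat.zero_le 7))) (hlt θ₁ (htK θ₁ hθ₁))
  filter_upwards [hev] with x hx θ hθ
  obtain ⟨θ₁, hθ₁, hball⟩ := Set.mem_iUnion₂.1 (hcov hθ)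
  exact (avg_mono (fun z => hle θ₁ (htK θ₁ hθ₁) θ ⟨hθ.1, hball⟩ z) _ _).trans_lt (hx θ₁ hθ₁)

lemma consistent (h : Regular ν f Θ θ₀) (hindep : iIndepFun Z P)
    (hlaw : ∀ i, HasLaw (Z i) (law ν f θ₀) P) {θhat : ℕ → Ω → ℝ} (hmle : IsMLE P f Θ Z θhat) :
    Tendsto (fun x : ℕ × Ω => θhat x.1 x.2) (inProb P) (𝓝 θ₀) := by
  rw [Metric.tendsto_nhds]
  intro ε hε
  filter_upwards [h.eventually_avg_logDensity_lt hindep hlaw hε, eventually_isMaxOn hmle]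
    with x hx hmax
  by_contra hcon
  exact absurd (hmax.2 h.mem) (not_le.2 (hx _ ⟨hmax.1, hcon⟩))

end Regular

/-! ### The third-order expansion of the maximum likelihood estimator -/

/-- Iterated substitution in the expanded score equation. With `s = n^{-1/2}` and `D` the
normalized estimation error, the equation `I D = U + s(…) + s²(…) + s³ R` determines `D` up to
order `s³`; the coefficients are `A₁`, `A₂`, `A₃`, and the three remainders `T₁`, `T₂`, `T₃` are
polynomials in the data of the equation. -/
lemma score_expansion_solve {I i s U V W D R Q₁ Q₂ a₁ a₂ a₃ T₁ T₂ T₃ : ℝ} (hi : i * I = 1)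
    (h : I * D = U + s * (V * D + Q₁ * D ^ 2 / 2) + s ^ 2 * (W * D ^ 2 / 2 + Q₂ * D ^ 3 / 6)
      + s ^ 3 * R)
    (ha₁ : a₁ = i * U) (ha₂ : a₂ = 1 / 2 * i ^ 3 * Q₁ * U ^ 2 + i ^ 2 * U * V)
    (ha₃ : a₃ = 1 / 6 * i ^ 4 * Q₂ * U ^ 3 + 1 / 2 * i ^ 5 * Q₁ ^ 2 * U ^ 3
      + 3 / 2 * i ^ 4 * Q₁ * U ^ 2 * V + 1 / 2 * i ^ 3 * U ^ 2 * W + i ^ 3 * U * V ^ 2)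
    (hT₁ : T₁ = i * (V * D + Q₁ * D ^ 2 / 2 + s * (W * D ^ 2 / 2 + Q₂ * D ^ 3 / 6) + s ^ 2 * R))
    (hT₂ : T₂ = i * (V * T₁ + Q₁ / 2 * ((D + a₁) * T₁) + W * D ^ 2 / 2 + Q₂ * D ^ 3 / 6 + s * R))
    (hT₃ : T₃ = i * (V * T₂ + Q₁ / 2 * (T₁ ^ 2 + 2 * (a₁ * T₂)) + W / 2 * (T₁ * (D + a₁))
      + Q₂ / 6 * (T₁ * (D ^ 2 + D * a₁ + a₁ ^ 2)) + R)) :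
    D = a₁ + s * T₁ ∧ D = a₁ + s * a₂ + s ^ 2 * a₃ + s ^ 3 * T₃ := by
  have h1 : D = a₁ + s * T₁ := by
    rw [ha₁, hT₁]
    linear_combination i * h - D * hi
  have ha₂' : a₂ = i * (V * a₁ + Q₁ * a₁ ^ 2 / 2) := by rw [ha₁, ha₂]; ring
  have ha₃' : a₃ = i * (V * a₂ + Q₁ * (a₁ * a₂) + W * a₁ ^ 2 / 2 + Q₂ * a₁ ^ 3 / 6) := by
    rw [ha₁, ha₂, ha₃]; ring
  have h2 : T₁ = a₂ + s * T₂ := by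
    rw [hT₂, ha₂']
    linear_combination hT₁ + i * (V + Q₁ / 2 * (D + a₁)) * h1
  have h3 : T₂ = a₃ + s * T₃ := by
    rw [hT₃, ha₃']
    linear_combination hT₂ + i * (V + Q₁ * a₁) * h2
      + i * (Q₁ / 2 * T₁ + W / 2 * (D + a₁) + Q₂ / 6 * (D ^ 2 + D * a₁ + a₁ ^ 2)) * h1
  refine ⟨h1, ?_⟩
  linear_combination h1 + s * h2 + s ^ 2 * h3

lemma avg_score_eq {𝒵 Ω : Type*} {f : 𝒵 → ℝ → ℝ} {Θ : Set ℝ} {θ₀ : ℝ} {Z : ℕ → Ω → 𝒵}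
    (n : ℕ) (hn : 0 < n) (ω : Ω) :
    avg Z (fun z => dlog f Θ 1 z θ₀) n ω =
      (Real.sqrt n)⁻¹ * normSum Z (fun z => dlog f Θ 1 z θ₀) n ω := by
  rw [avg_eq_add_normSum _ 0 hn]
  simp

namespace Regular

variable {𝒵 : Type*} [MeasurableSpace 𝒵] {ν : Measure 𝒵} {f : 𝒵 → ℝ → ℝ} {Θ : Set ℝ} {θ₀ : ℝ}
variable {Ω : Type*} {Z : ℕ → Ω → 𝒵}

lemma exists_ball_subset (h : Regular ν f Θ θ₀) : ∃ r > 0, Metric.ball θ₀ r ⊆ interior Θ :=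
  Metric.isOpen_iff.1 isOpen_interior θ₀ h.mem_interior

lemma abs_avg_score_sub_le_first (h : Regular ν f Θ θ₀) {M : 𝒵 → ℝ} (hM0 : ∀ z, 0 ≤ M z)
    (hM : ∀ z, ∀ θ ∈ Θ, ∀ k ≤ 7, |dlog f Θ k z θ| ≤ M z) {r θ : ℝ}
    (hr : Metric.ball θ₀ r ⊆ interior Θ) (hθ : θ ∈ Metric.ball θ₀ r) (n : ℕ) (ω : Ω) :
    |avg Z (fun z => dlog f Θ 1 z θ) n ω - (avg Z (fun z => dlog f Θ 1 z θ₀) n ω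
      + avg Z (fun z => dlog f Θ 2 z θ₀) n ω * (θ - θ₀))| ≤ avg Z M n ω * |θ - θ₀| ^ 2 := by
  have := abs_avg_le (Z := Z) (n := n) (ω := ω) fun z =>
    taylor_first_order (hM0 z) (g := fun k => dlog f Θ (k + 1) z)
      (fun k hk t ht => h.hasDerivAt_dlog z (hr ht) (by omega))
      (fun t ht => hM z t (interior_subset (hr ht)) 3 (by norm_num)) hθ
  simpa only [avg_sub, avg_add, avg_mul_const, zero_add] using this

lemma abs_avg_score_sub_le_third (h : Regular ν f Θ θ₀) {M : 𝒵 → ℝ} (hM0 : ∀ z, 0 ≤ M z)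
    (hM : ∀ z, ∀ θ ∈ Θ, ∀ k ≤ 7, |dlog f Θ k z θ| ≤ M z) {r θ : ℝ}
    (hr : Metric.ball θ₀ r ⊆ interior Θ) (hθ : θ ∈ Metric.ball θ₀ r) (n : ℕ) (ω : Ω) :
    |avg Z (fun z => dlog f Θ 1 z θ) n ω - (avg Z (fun z => dlog f Θ 1 z θ₀) n ω
      + avg Z (fun z => dlog f Θ 2 z θ₀) n ω * (θ - θ₀)
      + avg Z (fun z => dlog f Θ 3 z θ₀) n ω * ((θ - θ₀) ^ 2 / 2)
      + avg Z (fun z => dlog f Θ 4 z θ₀) n ω * ((θ - θ₀) ^ 3 / 6))|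
      ≤ avg Z M n ω * |θ - θ₀| ^ 4 := by
  have := abs_avg_le (Z := Z) (n := n) (ω := ω) fun z =>
    taylor_third_order (hM0 z) (g := fun k => dlog f Θ (k + 1) z)
      (fun k hk t ht => h.hasDerivAt_dlog z (hr ht) (by omega))
      (fun t ht => hM z t (interior_subset (hr ht)) 5 (by norm_num)) hθ
  simpa only [avg_sub, avg_add, avg_mul_const, zero_add, Nat.reduceAdd] using this

lemma abs_avg_m_sub_le (h : Regular ν f Θ θ₀) {M : 𝒵 → ℝ} (hM0 : ∀ z, 0 ≤ M z)
    (hM : ∀ z, ∀ θ ∈ Θ, ∀ k ≤ 7, |dlog f Θ k z θ| ≤ M z) {r θ : ℝ}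
    (hr : Metric.ball θ₀ r ⊆ interior Θ) (hθ : θ ∈ Metric.ball θ₀ r) (j : Fin 3) (n : ℕ) (ω : Ω) :
    |avg Z (fun z => m f Θ z θ j) n ω - (avg Z (fun z => m f Θ z θ₀ j) n ω
      + avg Z (fun z => mDer1 f Θ z θ₀ j) n ω * (θ - θ₀))|
      ≤ avg Z (fun z => M z + 4 * M z ^ 2) n ω * |θ - θ₀| ^ 2 := by
  have := abs_avg_le (Z := Z) (n := n) (ω := ω) fun z =>
    taylor_first_order (C := M z + 4 * M z ^ 2)
      (add_nonneg (hM0 z) (by positivity))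
      (g := fun k => match k with
        | 0 => fun t => m f Θ z t j
        | 1 => fun t => mDer1 f Θ z t j
        | _ => fun t => mDer2 f Θ z t j)
      (fun k hk t ht => by
        interval_cases k
        · exact h.hasDerivAt_m z (hr ht) j
        · exact h.hasDerivAt_mDer1 z (hr ht) j)
      (fun t ht => abs_mDer2_le hM0 hM z (interior_subset (hr ht)) j) hθ
  simpa only [avg_sub, avg_add, avg_mul_const] using this

lemma avg_dlog_eq (k : ℕ) (n : ℕ) (hn : 0 < n) (ω : Ω) :
    avg Z (fun z => dlog f Θ k z θ₀) n ω =
      meanDlog ν f Θ θ₀ k + (Real.sqrt n)⁻¹ * centSum ν f Θ θ₀ Z k n ω :=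
  avg_eq_add_normSum _ _ hn ω

variable [MeasurableSpace Ω] {P : Measure Ω} [IsProbabilityMeasure P] {θhat : ℕ → Ω → ℝ}

/-- The score equation: with probability tending to one the estimator is an interior maximizer. -/
lemma eventually_score_eq_zero (h : Regular ν f Θ θ₀) (hindep : iIndepFun Z P)
    (hlaw : ∀ i, HasLaw (Z i) (law ν f θ₀) P) (hmle : IsMLE P f Θ Z θhat) :
    ∀ᶠ x in inProb P, avg Z (fun z => dlog f Θ 1 z (θhat x.1 x.2)) x.1 x.2 = 0 := by
  filter_upwards [(h.consistent hindep hlaw hmle).eventually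
    (isOpen_interior.mem_nhds h.mem_interior), eventually_isMaxOn hmle] with x hint hmax
  refine (hmax.2.isLocalMax (mem_interior_iff_mem_nhds.1 hint)).hasDerivAt_eq_zero ?_
  exact (HasDerivAt.fun_sum fun i _ =>
    h.hasDerivAt_dlog (Z i x.2) hint (k := 0) (by norm_num)).const_mul _

lemma bddInProb_score (h : Regular ν f Θ θ₀) (hindep : iIndepFun Z P)
    (hlaw : ∀ i, HasLaw (Z i) (law ν f θ₀) P) :
    BddInProb P (fun x => normSum Z (fun z => dlog f Θ 1 z θ₀) x.1 x.2) :=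
  bddInProb_normSum hindep hlaw (h.memLp_dlog (by norm_num)) h.integral_score

lemma bddInProb_centSum (h : Regular ν f Θ θ₀) (hindep : iIndepFun Z P)
    (hlaw : ∀ i, HasLaw (Z i) (law ν f θ₀) P) {k : ℕ} (hk : k ≤ 7) :
    BddInProb P (fun x => centSum ν f Θ θ₀ Z k x.1 x.2) :=
  bddInProb_normSum hindep hlaw (h.memLp_dlog_sub_mean hk) (h.integral_dlog_sub_mean hk)

/-- The rate of convergence: `√n (θ̂ - θ₀) = O_p(1)`. -/
lemma bddInProb_estimation_error (h : Regular ν f Θ θ₀) (hindep : iIndepFun Z P)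
    (hlaw : ∀ i, HasLaw (Z i) (law ν f θ₀) P) (hmle : IsMLE P f Θ Z θhat) :
    BddInProb P (fun x => Real.sqrt x.1 * (θhat x.1 x.2 - θ₀)) := by
  obtain ⟨M, hM0, hM, hMi⟩ := h.exists_envelope
  obtain ⟨r, hr, hball⟩ := h.exists_ball_subset
  have hI := h.info_pos
  have hcons := h.consistent hindep hlaw hmle
  have hM1 : Integrable M (law ν f θ₀) := by simpa using hMi 1 (by norm_num)
  have hd0 : Tendsto (fun x : ℕ × Ω => |θhat x.1 x.2 - θ₀|) (inProb P) (𝓝 0) := by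
    simpa using (hcons.sub_const θ₀).abs
  have hs0 : Tendsto (fun x : ℕ × Ω => (Real.sqrt x.1)⁻¹) (inProb P) (𝓝 0) :=
    tendsto_inv_sqrt_nat.comp tendsto_fst_inProb
  have hsmall : Tendsto (fun x : ℕ × Ω => |(Real.sqrt x.1)⁻¹ * centSum ν f Θ θ₀ Z 2 x.1 x.2|
      + |θhat x.1 x.2 - θ₀| * avg Z M x.1 x.2) (inProb P) (𝓝 0) := by
    have h1 := ((h.bddInProb_centSum hindep hlaw (k := 2) (by norm_num)).tendsto_smul hs0).abs
    have h2 := (bddInProb_avg hlaw hM1).tendsto_smul hd0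
    simpa only [abs_zero, add_zero, smul_eq_mul] using h1.add h2
  refine ((h.bddInProb_score hindep hlaw).const_mul (2 / info ν f Θ θ₀)).of_norm_le ?_
  filter_upwards [hcons.eventually (Metric.ball_mem_nhds θ₀ hr), eventually_fst_pos,
    h.eventually_score_eq_zero hindep hlaw hmle,
    hsmall.eventually_lt_const (half_pos hI)] with x hx hn hscore hlt
  have hT := h.abs_avg_score_sub_le_first hM0 hM hball hx x.1 x.2 (Z := Z)
  rw [hscore, avg_score_eq x.1 hn, avg_dlog_eq (ν := ν) 2 x.1 hn] at hT
  have hmean : meanDlog ν f Θ θ₀ 2 = -info ν f Θ θ₀ := by simp [info]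
  rw [hmean] at hT
  set I := info ν f Θ θ₀
  set U := normSum Z (fun z => dlog f Θ 1 z θ₀) x.1 x.2
  set V := centSum ν f Θ θ₀ Z 2 x.1 x.2
  set d := θhat x.1 x.2 - θ₀
  set B := avg Z M x.1 x.2
  have hsq : 0 < Real.sqrt x.1 := Real.sqrt_pos.2 (Nat.cast_pos.2 hn)
  set s := (Real.sqrt x.1)⁻¹ with hs
  have hspos : 0 < s := inv_pos.2 hsq
  have h1 : I * |d| ≤ s * |U| + (|s * V| + |d| * B) * |d| := by
    have e : I * d = s * U + s * V * d + (0 - (s * U + (-I + s * V) * d)) := by ring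
    calc I * |d| = |I * d| := by rw [abs_mul, abs_of_pos hI]
      _ ≤ |s * U| + |s * V * d| + |0 - (s * U + (-I + s * V) * d)| := by
          rw [e]; exact abs_add_three _ _ _
      _ ≤ s * |U| + |s * V| * |d| + B * |d| ^ 2 := by
          rw [abs_mul s U, abs_of_pos hspos, abs_mul (s * V) d]
          exact add_le_add le_rfl hT
      _ = s * |U| + (|s * V| + |d| * B) * |d| := by ring
  have h2 : (|s * V| + |d| * B) * |d| ≤ I / 2 * |d| :=
    mul_le_mul_of_nonneg_right hlt.le (abs_nonneg _)
  have h3 : |d| ≤ 2 / I * (s * |U|) := by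
    rw [div_mul_eq_mul_div, le_div_iff₀ hI]
    nlinarith
  rw [Real.norm_eq_abs, Real.norm_eq_abs, abs_mul, abs_mul, abs_of_pos hsq,
    abs_of_pos (div_pos two_pos hI)]
  calc Real.sqrt x.1 * |d| ≤ Real.sqrt x.1 * (2 / I * (s * |U|)) := by gcongr
    _ = 2 / I * |U| * (Real.sqrt x.1 * s) := by ring
    _ = 2 / I * |U| := by rw [hs, mul_inv_cancel₀ hsq.ne', mul_one]

/-- The expansion of the maximum likelihood estimator to first order, and to third order. -/
lemma mle_expansion (h : Regular ν f Θ θ₀) (hindep : iIndepFun Z P)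
    (hlaw : ∀ i, HasLaw (Z i) (law ν f θ₀) P) (hmle : IsMLE P f Θ Z θhat) :
    Tendsto (fun x : ℕ × Ω => Real.sqrt x.1 * (θhat x.1 x.2 - θ₀) - A1 ν f Θ θ₀ Z x.1 x.2)
      (inProb P) (𝓝 0) ∧
    Tendsto (fun x : ℕ × Ω => (x.1 : ℝ) * (Real.sqrt x.1 * (θhat x.1 x.2 - θ₀)
      - (A1 ν f Θ θ₀ Z x.1 x.2 + (Real.sqrt x.1)⁻¹ * A2 ν f Θ θ₀ Z x.1 x.2
        + (x.1 : ℝ)⁻¹ * A3 ν f Θ θ₀ Z x.1 x.2))) (inProb P) (𝓝 0) := by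
  obtain ⟨M, hM0, hM, hMi⟩ := h.exists_envelope
  obtain ⟨r, hr, hball⟩ := h.exists_ball_subset
  have hI := h.info_pos
  have hcons := h.consistent hindep hlaw hmle
  have hM1 : Integrable M (law ν f θ₀) := by simpa using hMi 1 (by norm_num)
  have hs0 : Tendsto (fun x : ℕ × Ω => (Real.sqrt x.1)⁻¹) (inProb P) (𝓝 0) :=
    tendsto_inv_sqrt_nat.comp tendsto_fst_inProb
  let s : ℕ × Ω → ℝ := fun x => (Real.sqrt x.1)⁻¹
  let D : ℕ × Ω → ℝ := fun x => Real.sqrt x.1 * (θhat x.1 x.2 - θ₀)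
  let U : ℕ × Ω → ℝ := fun x => normSum Z (fun z => dlog f Θ 1 z θ₀) x.1 x.2
  let V : ℕ × Ω → ℝ := fun x => centSum ν f Θ θ₀ Z 2 x.1 x.2
  let W : ℕ × Ω → ℝ := fun x => centSum ν f Θ θ₀ Z 3 x.1 x.2
  let Y : ℕ × Ω → ℝ := fun x => centSum ν f Θ θ₀ Z 4 x.1 x.2
  set I := info ν f Θ θ₀ with hIdef
  set Q₁ := meanDlog ν f Θ θ₀ 3 with hQ₁
  set Q₂ := meanDlog ν f Θ θ₀ 4 with hQ₂
  have hmean : meanDlog ν f Θ θ₀ 2 = -I := by simp [hIdef, info]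
  -- the remainder of the score equation, normalized to be `O_p(1)`
  let R : ℕ × Ω → ℝ := fun x => Real.sqrt x.1 ^ 3 * (I * D x - (U x
    + s x * (V x * D x + Q₁ * D x ^ 2 / 2)
    + s x ^ 2 * (W x * D x ^ 2 / 2 + Q₂ * D x ^ 3 / 6)))
  have bs : BddInProb P s := BddInProb.of_tendsto hs0
  have bD : BddInProb P D := h.bddInProb_estimation_error hindep hlaw hmle
  have bU : BddInProb P U := h.bddInProb_score hindep hlaw
  have bV : BddInProb P V := h.bddInProb_centSum hindep hlaw (by norm_num)
  have bW : BddInProb P W := h.bddInProb_centSum hindep hlaw (by norm_num)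
  have bY : BddInProb P Y := h.bddInProb_centSum hindep hlaw (by norm_num)
  have bB := bddInProb_avg hlaw hM1
  have babs : ∀ {X : ℕ × Ω → ℝ}, BddInProb P X → BddInProb P (fun x => |X x|) := fun hX =>
    hX.of_norm_le (Eventually.of_forall fun x => by simp)
  have bR : BddInProb P R := by
    refine (((babs (bY.mul (bD.pow 3))).const_mul (1 / 6)).add
      (bB.mul ((babs bD).pow 4))).of_norm_le ?_
    filter_upwards [hcons.eventually (Metric.ball_mem_nhds θ₀ hr), eventually_fst_pos,
      h.eventually_score_eq_zero hindep hlaw hmle] with x hx hn hscore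
    have hT := h.abs_avg_score_sub_le_third hM0 hM hball hx x.1 x.2 (Z := Z)
    rw [hscore, avg_score_eq x.1 hn, avg_dlog_eq (ν := ν) 2 x.1 hn,
      avg_dlog_eq (ν := ν) 3 x.1 hn, avg_dlog_eq (ν := ν) 4 x.1 hn, hmean] at hT
    have hsq : 0 < Real.sqrt x.1 := Real.sqrt_pos.2 (Nat.cast_pos.2 hn)
    have hspos : 0 < s x := inv_pos.2 hsq
    have hss : Real.sqrt x.1 * s x = 1 := mul_inv_cancel₀ hsq.ne'
    have hd : θhat x.1 x.2 - θ₀ = s x * D x := by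
      simp only [s, D]
      rw [inv_mul_cancel_left₀ hsq.ne']
    rw [hd] at hT
    have e : R x = -(Real.sqrt x.1 ^ 4 * (s x * U x + (-I + s x * V x) * (s x * D x)
          + (Q₁ + s x * W x) * ((s x * D x) ^ 2 / 2)
          + (Q₂ + s x * Y x) * ((s x * D x) ^ 3 / 6))) + 1 / 6 * (Y x * D x ^ 3) := by
      have hq : Real.sqrt x.1 = (s x)⁻¹ := by simp [s]
      simp only [R]
      rw [hq]
      field_simp
      ring
    have hT' : |s x * U x + (-I + s x * V x) * (s x * D x)
          + (Q₁ + s x * W x) * ((s x * D x) ^ 2 / 2)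
          + (Q₂ + s x * Y x) * ((s x * D x) ^ 3 / 6)|
        ≤ avg Z M x.1 x.2 * |s x * D x| ^ 4 := by
      rw [zero_sub, abs_neg] at hT
      exact hT
    have hB0 : 0 ≤ avg Z M x.1 x.2 :=
      mul_nonneg (by positivity) (Finset.sum_nonneg fun _ _ => hM0 _)
    have e2 : Real.sqrt x.1 ^ 4 * (avg Z M x.1 x.2 * |s x * D x| ^ 4)
        = avg Z M x.1 x.2 * |D x| ^ 4 := by
      rw [abs_mul, abs_of_pos hspos]
      calc Real.sqrt x.1 ^ 4 * (avg Z M x.1 x.2 * (s x * |D x|) ^ 4)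
          = (Real.sqrt x.1 * s x) ^ 4 * (avg Z M x.1 x.2 * |D x| ^ 4) := by ring
        _ = _ := by rw [hss, one_pow, one_mul]
    rw [Real.norm_eq_abs, Real.norm_of_nonneg (by positivity), e]
    refine (abs_add_le _ _).trans ?_
    rw [abs_neg, abs_mul (Real.sqrt x.1 ^ 4), abs_of_nonneg (by positivity : 0 ≤ Real.sqrt x.1 ^ 4),
      abs_mul (1 / 6 : ℝ), abs_of_pos (by norm_num : (0 : ℝ) < 1 / 6), add_comm]
    refine add_le_add le_rfl ?_
    rw [← e2]
    exact mul_le_mul_of_nonneg_left hT' (by positivity)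
  let a₁ : ℕ × Ω → ℝ := fun x => A1 ν f Θ θ₀ Z x.1 x.2
  have ba₁ : BddInProb P a₁ := bU.const_mul _
  let T₁ : ℕ × Ω → ℝ := fun x => I⁻¹ * (V x * D x + Q₁ * D x ^ 2 / 2
    + s x * (W x * D x ^ 2 / 2 + Q₂ * D x ^ 3 / 6) + s x ^ 2 * R x)
  have bq : BddInProb P (fun x => W x * D x ^ 2 / 2 + Q₂ * D x ^ 3 / 6) := by
    have := ((bW.mul (bD.pow 2)).mul (.const (1 / 2))).add
      (((bD.pow 3).const_mul Q₂).mul (.const (1 / 6)))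
    simpa only [div_eq_mul_inv, one_mul] using this
  have bT₁ : BddInProb P T₁ := by
    have := ((bV.mul bD).add (((bD.pow 2).const_mul Q₁).mul (.const (1 / 2)))).add (bs.mul bq)
    have := (this.add ((bs.pow 2).mul bR)).const_mul I⁻¹
    simpa only [T₁, div_eq_mul_inv, one_mul] using this
  let T₂ : ℕ × Ω → ℝ := fun x => I⁻¹ * (V x * T₁ x + Q₁ / 2 * ((D x + a₁ x) * T₁ x)
    + W x * D x ^ 2 / 2 + Q₂ * D x ^ 3 / 6 + s x * R x)
  have bT₂ : BddInProb P T₂ := by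
    have := (((bV.mul bT₁).add (((bD.add ba₁).mul bT₁).const_mul (Q₁ / 2))).add bq).add
      (bs.mul bR)
    simpa only [T₂, add_assoc] using this.const_mul I⁻¹
  let T₃ : ℕ × Ω → ℝ := fun x => I⁻¹ * (V x * T₂ x + Q₁ / 2 * (T₁ x ^ 2 + 2 * (a₁ x * T₂ x))
    + W x / 2 * (T₁ x * (D x + a₁ x)) + Q₂ / 6 * (T₁ x * (D x ^ 2 + D x * a₁ x + a₁ x ^ 2))
    + R x)
  have bT₃ : BddInProb P T₃ := by
    have b1 := (bV.mul bT₂).add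
      (((bT₁.pow 2).add ((ba₁.mul bT₂).const_mul 2)).const_mul (Q₁ / 2))
    have b2 := (bW.mul (.const (1 / 2))).mul (bT₁.mul (bD.add ba₁))
    have b3 := (bT₁.mul (((bD.pow 2).add (bD.mul ba₁)).add (ba₁.pow 2))).const_mul (Q₂ / 6)
    have := (((b1.add b2).add b3).add bR).const_mul I⁻¹
    simpa only [T₃, div_eq_mul_inv, one_mul] using this
  have key : ∀ᶠ x in inProb P, D x = a₁ x + s x * T₁ x ∧
      D x = a₁ x + s x * A2 ν f Θ θ₀ Z x.1 x.2 + s x ^ 2 * A3 ν f Θ θ₀ Z x.1 x.2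
        + s x ^ 3 * T₃ x := by
    filter_upwards [eventually_fst_pos] with x hn
    have hsq : 0 < Real.sqrt x.1 := Real.sqrt_pos.2 (Nat.cast_pos.2 hn)
    have hss : s x ^ 3 * Real.sqrt x.1 ^ 3 = 1 := by
      rw [← mul_pow, inv_mul_cancel₀ hsq.ne', one_pow]
    have hR : R x = Real.sqrt x.1 ^ 3 * (I * D x - (U x
      + s x * (V x * D x + Q₁ * D x ^ 2 / 2)
      + s x ^ 2 * (W x * D x ^ 2 / 2 + Q₂ * D x ^ 3 / 6))) := rfl
    have hsolve : I * D x = U x + s x * (V x * D x + Q₁ * D x ^ 2 / 2)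
        + s x ^ 2 * (W x * D x ^ 2 / 2 + Q₂ * D x ^ 3 / 6) + s x ^ 3 * R x := by
      rw [hR, ← mul_assoc (s x ^ 3), hss]
      ring
    exact score_expansion_solve (inv_mul_cancel₀ hI.ne') hsolve rfl rfl rfl rfl rfl rfl
  constructor
  · refine (bT₁.tendsto_smul hs0).congr' ?_
    filter_upwards [key] with x hx
    rw [smul_eq_mul]
    linarith [hx.1]
  · refine (bT₃.tendsto_smul hs0).congr' ?_
    filter_upwards [key, eventually_fst_pos] with x hx hn
    have hn' : (0 : ℝ) < x.1 := Nat.cast_pos.2 hn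
    have hs2 : s x ^ 2 = (x.1 : ℝ)⁻¹ := by
      simp only [s]
      rw [inv_pow, Real.sq_sqrt hn'.le]
    have hns : (x.1 : ℝ) * s x ^ 2 = 1 := by rw [hs2, mul_inv_cancel₀ hn'.ne']
    rw [smul_eq_mul, ← hs2]
    linear_combination (-(x.1 : ℝ)) * hx.2 - s x * T₃ x * hns

end Regular

/-! ### Asymptotic linearity of the two bias estimates -/

lemma normSum_clm {𝒵 Ω : Type*} {Z : ℕ → Ω → 𝒵} (L : (Fin 3 → ℝ) →L[ℝ] ℝ)
    (v : 𝒵 → Fin 3 → ℝ) (n : ℕ) (ω : Ω) :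
    normSum Z (fun z => L (v z)) n ω = L (fun j => normSum Z (fun z => v z j) n ω) := by
  have : (fun j => normSum Z (fun z => v z j) n ω : Fin 3 → ℝ) =
      (Real.sqrt n)⁻¹ • ∑ i ∈ Finset.range n, v (Z i ω) := by
    ext j
    simp [normSum, Finset.sum_apply]
  rw [this, map_smul, map_sum]
  rfl

lemma normSum_const_mul {𝒵 Ω : Type*} {Z : ℕ → Ω → 𝒵} (φ : 𝒵 → ℝ) (c : ℝ) (n : ℕ) (ω : Ω) :
    normSum Z (fun z => c * φ z) n ω = c * normSum Z φ n ω := by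
  simp only [normSum, ← Finset.mul_sum]
  ring

lemma normSum_add {𝒵 Ω : Type*} {Z : ℕ → Ω → 𝒵} (φ ψ : 𝒵 → ℝ) (n : ℕ) (ω : Ω) :
    normSum Z (fun z => φ z + ψ z) n ω = normSum Z φ n ω + normSum Z ψ n ω := by
  simp only [normSum, Finset.sum_add_distrib, mul_add]

lemma asymptoticallyLinear_of_tendsto {𝒵 Ω : Type*} [MeasurableSpace 𝒵] [MeasurableSpace Ω]
    {P : Measure Ω} {Z : ℕ → Ω → 𝒵} {bEst : ℕ → Ω → ℝ} {b₀ : ℝ} {φ : 𝒵 → ℝ} {μ : Measure 𝒵}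
    (hφ : MemLp φ 2 μ) (hφ0 : ∫ z, φ z ∂μ = 0)
    (hb : Tendsto (fun x : ℕ × Ω => Real.sqrt x.1 * (bEst x.1 x.2 - b₀) - normSum Z φ x.1 x.2)
      (inProb P) (𝓝 0)) : AsymptoticallyLinear P μ Z bEst b₀ φ := by
  refine ⟨hφ, hφ0, ?_⟩
  simpa only [IsLittleOp, div_one] using tendsto_inProb_iff.1 hb

namespace Regular

variable {𝒵 : Type*} [MeasurableSpace 𝒵] {ν : Measure 𝒵} {f : 𝒵 → ℝ → ℝ} {Θ : Set ℝ} {θ₀ : ℝ}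

lemma memLp_inflC (h : Regular ν f Θ θ₀) : MemLp (inflC ν f Θ θ₀) 2 (law ν f θ₀) :=
  ((h.memLp_dlog (k := 1) (by norm_num)).const_mul _).const_mul _

lemma integral_inflC (h : Regular ν f Θ θ₀) : ∫ z, inflC ν f Θ θ₀ z ∂(law ν f θ₀) = 0 := by
  simp only [inflC]
  rw [integral_const_mul, integral_const_mul, h.integral_score, mul_zero, mul_zero]

/-- The argument of `τ_m` in the influence function of the sample-average version is square
integrable. -/
lemma memLp_inflA_arg (h : Regular ν f Θ θ₀) (j : Fin 3) :
    MemLp (fun z => (((info ν f Θ θ₀)⁻¹ * dlog f Θ 1 z θ₀) • mDeriv ν f Θ θ₀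
      + (m f Θ z θ₀ - mBar ν f Θ θ₀)) j) 2 (law ν f θ₀) := by
  have hprob := h.isProbabilityMeasure_law
  have h1 := ((h.memLp_dlog (k := 1) (by norm_num)).const_mul (info ν f Θ θ₀)⁻¹).mul_const
    (mDeriv ν f Θ θ₀ j)
  exact h1.add ((h.memLp_m j).sub (memLp_const (mBar ν f Θ θ₀ j)))

/-- The argument of `τ_m` in the influence function of the sample-average version has mean zero. -/
lemma integral_inflA_arg (h : Regular ν f Θ θ₀) (j : Fin 3) :
    ∫ z, (((info ν f Θ θ₀)⁻¹ * dlog f Θ 1 z θ₀) • mDeriv ν f Θ θ₀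
      + (m f Θ z θ₀ - mBar ν f Θ θ₀)) j ∂(law ν f θ₀) = 0 := by
  have hprob := h.isProbabilityMeasure_law
  have h1 : Integrable (fun z => (info ν f Θ θ₀)⁻¹ * dlog f Θ 1 z θ₀ * mDeriv ν f Θ θ₀ j)
      (law ν f θ₀) :=
    (((h.memLp_dlog (k := 1) (by norm_num)).integrable (by norm_num)).const_mul _).mul_const _
  have h2 : Integrable (fun z => m f Θ z θ₀ j) (law ν f θ₀) :=
    (h.memLp_m j).integrable (by norm_num)
  have h3 : Integrable (fun z => m f Θ z θ₀ j - mBar ν f Θ θ₀ j) (law ν f θ₀) :=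
    h2.sub (integrable_const _)
  simp only [Pi.add_apply, Pi.smul_apply, smul_eq_mul, Pi.sub_apply]
  rw [integral_add h1 h3, integral_sub h2 (integrable_const _),
    integral_mul_const, integral_const_mul, h.integral_score]
  simp [mBar]

lemma memLp_inflA (h : Regular ν f Θ θ₀) : MemLp (inflA ν f Θ θ₀) 2 (law ν f θ₀) :=
  (tauM ν f Θ θ₀).comp_memLp' (memLp_pi_iff.2 h.memLp_inflA_arg)

lemma integral_inflA (h : Regular ν f Θ θ₀) : ∫ z, inflA ν f Θ θ₀ z ∂(law ν f θ₀) = 0 := by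
  have hprob := h.isProbabilityMeasure_law
  have hint : Integrable (fun z => ((info ν f Θ θ₀)⁻¹ * dlog f Θ 1 z θ₀) • mDeriv ν f Θ θ₀
      + (m f Θ z θ₀ - mBar ν f Θ θ₀)) (law ν f θ₀) :=
    Integrable.of_eval fun j => (h.memLp_inflA_arg j).integrable (by norm_num)
  have h0 : ∫ z, (((info ν f Θ θ₀)⁻¹ * dlog f Θ 1 z θ₀) • mDeriv ν f Θ θ₀
      + (m f Θ z θ₀ - mBar ν f Θ θ₀)) ∂(law ν f θ₀) = 0 := by
    ext j
    rw [eval_integral fun j => (h.memLp_inflA_arg j).integrable (by norm_num)]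
    exact h.integral_inflA_arg j
  have h3 := (tauM ν f Θ θ₀).integral_comp_comm hint
  rw [h0, map_zero] at h3
  exact h3

variable {Ω : Type*} [MeasurableSpace Ω] {P : Measure Ω} [IsProbabilityMeasure P]
  {Z : ℕ → Ω → 𝒵} {θhat : ℕ → Ω → ℝ}

/-- Asymptotic linearity of `b(θ̂)`, from the differentiability of `b` and the first-order expansion
of `θ̂`. -/
lemma bias_linear (h : Regular ν f Θ θ₀) (hindep : iIndepFun Z P)
    (hlaw : ∀ i, HasLaw (Z i) (law ν f θ₀) P) (hmle : IsMLE P f Θ Z θhat) :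
    Tendsto (fun x : ℕ × Ω => Real.sqrt x.1 * (bias ν f Θ (θhat x.1 x.2) - bias ν f Θ θ₀)
      - normSum Z (inflC ν f Θ θ₀) x.1 x.2) (inProb P) (𝓝 0) := by
  set c := tauM ν f Θ θ₀ (mDeriv ν f Θ θ₀ + mScore ν f Θ θ₀) with hc
  have h1 := (h.bddInProb_estimation_error hindep hlaw hmle).delta_method tendsto_inv_sqrt_nat
    h.hasDerivAt_bias.hasFDerivAt
  have h2 := ((h.mle_expansion hindep hlaw hmle).1).const_mul c
  rw [mul_zero] at h2
  have h3 := h1.add h2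
  rw [add_zero] at h3
  refine h3.congr' ?_
  filter_upwards [eventually_fst_pos] with x hn
  have hsq : 0 < Real.sqrt x.1 := Real.sqrt_pos.2 (Nat.cast_pos.2 hn)
  have hN : normSum Z (inflC ν f Θ θ₀) x.1 x.2 = c * A1 ν f Θ θ₀ Z x.1 x.2 := by
    rw [A1, ← normSum_const_mul, ← normSum_const_mul]
    rfl
  rw [hN]
  simp only [smul_eq_mul, inv_inv, inv_mul_cancel_left₀ hsq.ne', add_sub_cancel,
    ContinuousLinearMap.toSpanSingleton_apply]
  ring

/-- The vector of sample averages `n⁻¹ ∑ m(Zᵢ, θ̂)` is asymptotically linear, with influence function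
`M 𝓘⁻¹ ℓ + m - m̄`. -/
lemma average_m_linear (h : Regular ν f Θ θ₀) (hindep : iIndepFun Z P)
    (hlaw : ∀ i, HasLaw (Z i) (law ν f θ₀) P) (hmle : IsMLE P f Θ Z θhat) (j : Fin 3) :
    Tendsto (fun x : ℕ × Ω =>
      Real.sqrt x.1 * (avg Z (fun z => m f Θ z (θhat x.1 x.2) j) x.1 x.2 - mBar ν f Θ θ₀ j)
      - normSum Z (fun z => (((info ν f Θ θ₀)⁻¹ * dlog f Θ 1 z θ₀) • mDeriv ν f Θ θ₀
        + (m f Θ z θ₀ - mBar ν f Θ θ₀)) j) x.1 x.2) (inProb P) (𝓝 0) := by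
  obtain ⟨M, hM0, hM, hMi⟩ := h.exists_envelope
  obtain ⟨r, hr, hball⟩ := h.exists_ball_subset
  have hEi : Integrable (fun z => M z + 4 * M z ^ 2) (law ν f θ₀) := by
    have h1 := hMi 1 (by norm_num)
    simp only [pow_one] at h1
    exact h1.add ((hMi 2 (by norm_num)).const_mul 4)
  have bD := h.bddInProb_estimation_error hindep hlaw hmle
  have hs0 : Tendsto (fun x : ℕ × Ω => (Real.sqrt x.1)⁻¹) (inProb P) (𝓝 0) :=
    tendsto_inv_sqrt_nat.comp tendsto_fst_inProb
  -- the Taylor remainder is of order `n^{-1/2}`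
  have hrem : Tendsto (fun x : ℕ × Ω => Real.sqrt x.1 *
      (avg Z (fun z => m f Θ z (θhat x.1 x.2) j) x.1 x.2
        - (avg Z (fun z => m f Θ z θ₀ j) x.1 x.2
        + avg Z (fun z => mDer1 f Θ z θ₀ j) x.1 x.2 * (θhat x.1 x.2 - θ₀)))) (inProb P) (𝓝 0) := by
    refine squeeze_zero_norm' ?_
      (((bddInProb_avg hlaw hEi).mul (bD.pow 2)).tendsto_smul hs0)
    filter_upwards [(h.consistent hindep hlaw hmle).eventually (Metric.ball_mem_nhds θ₀ hr),
      eventually_fst_pos] with x hx hn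
    have hsq : 0 < Real.sqrt x.1 := Real.sqrt_pos.2 (Nat.cast_pos.2 hn)
    have hT := h.abs_avg_m_sub_le hM0 hM hball hx j x.1 x.2 (Z := Z)
    rw [Real.norm_eq_abs, abs_mul, abs_of_pos hsq]
    refine (mul_le_mul_of_nonneg_left hT hsq.le).trans (le_of_eq ?_)
    have hss : (Real.sqrt x.1)⁻¹ * Real.sqrt x.1 ^ 2 = Real.sqrt x.1 := by
      rw [sq, inv_mul_cancel_left₀ hsq.ne']
    rw [smul_eq_mul, sq_abs, mul_pow]
    linear_combination (-(avg Z (fun z => M z + 4 * M z ^ 2) x.1 x.2)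
      * (θhat x.1 x.2 - θ₀) ^ 2) * hss
  -- the law of large numbers for `∂m/∂θ`
  have hder := bD.tendsto_smul (by
    have := (tendsto_avg_inProb hindep hlaw (h.memLp_mDer1 j)).sub_const (mDeriv ν f Θ θ₀ j)
    rwa [← h.mDeriv_eq, sub_self] at this)
  have hlin := ((h.mle_expansion hindep hlaw hmle).1).const_mul (mDeriv ν f Θ θ₀ j)
  rw [mul_zero] at hlin
  have hsum := (hrem.add hder).add hlin
  rw [add_zero, add_zero] at hsum
  refine hsum.congr' ?_
  filter_upwards [eventually_fst_pos] with x hn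
  have hsq : 0 < Real.sqrt x.1 := Real.sqrt_pos.2 (Nat.cast_pos.2 hn)
  have hN : normSum Z (fun z => (((info ν f Θ θ₀)⁻¹ * dlog f Θ 1 z θ₀) • mDeriv ν f Θ θ₀
        + (m f Θ z θ₀ - mBar ν f Θ θ₀)) j) x.1 x.2 = mDeriv ν f Θ θ₀ j * A1 ν f Θ θ₀ Z x.1 x.2
      + normSum Z (fun z => m f Θ z θ₀ j - mBar ν f Θ θ₀ j) x.1 x.2 := by
    simp only [Pi.add_apply, Pi.smul_apply, smul_eq_mul, Pi.sub_apply, normSum_add, A1]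
    congr 1
    rw [← normSum_const_mul, ← normSum_const_mul]
    congr 1
    ext z
    ring
  rw [hN, avg_eq_add_normSum (fun z => m f Θ z θ₀ j) (mBar ν f Θ θ₀ j) hn]
  have hss : Real.sqrt x.1 * (Real.sqrt x.1)⁻¹ = 1 := mul_inv_cancel₀ hsq.ne'
  simp only [smul_eq_mul]
  linear_combination
    (-normSum Z (fun z => m f Θ z θ₀ j - mBar ν f Θ θ₀ j) x.1 x.2) * hss

/-- Asymptotic linearity of `b̂(θ̂)`, by the delta method applied to `τ`. -/
lemma biasHat_linear (h : Regular ν f Θ θ₀) (hindep : iIndepFun Z P)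
    (hlaw : ∀ i, HasLaw (Z i) (law ν f θ₀) P) (hmle : IsMLE P f Θ Z θhat) :
    Tendsto (fun x : ℕ × Ω => Real.sqrt x.1 * (biasHat f Θ Z x.1 x.2 (θhat x.1 x.2)
      - bias ν f Θ θ₀) - normSum Z (inflA ν f Θ θ₀) x.1 x.2) (inProb P) (𝓝 0) := by
  let a : ℕ × Ω → Fin 3 → ℝ := fun x j => avg Z (fun z => m f Θ z (θhat x.1 x.2) j) x.1 x.2
  let T : ℕ × Ω → Fin 3 → ℝ := fun x => Real.sqrt x.1 • (a x - mBar ν f Θ θ₀)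
  let N : ℕ × Ω → Fin 3 → ℝ := fun x j =>
    normSum Z (fun z => (((info ν f Θ θ₀)⁻¹ * dlog f Θ 1 z θ₀) • mDeriv ν f Θ θ₀
        + (m f Θ z θ₀ - mBar ν f Θ θ₀)) j) x.1 x.2
  have hTN : ∀ j, Tendsto (fun x => T x j - N x j) (inProb P) (𝓝 0) := fun j =>
    h.average_m_linear hindep hlaw hmle j
  have bN : ∀ j, BddInProb P (fun x => N x j) := fun j =>
    bddInProb_normSum hindep hlaw (h.memLp_inflA_arg j) (h.integral_inflA_arg j)
  have bT : BddInProb P T := BddInProb.pi fun j => by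
    have := (BddInProb.of_tendsto (hTN j)).add (bN j)
    simpa only [sub_add_cancel] using this
  have h1 := bT.delta_method tendsto_inv_sqrt_nat h.hasFDerivAt_tau
  have h2 : Tendsto (fun x => tauM ν f Θ θ₀ (T x - N x)) (inProb P) (𝓝 0) := by
    have h3 : Tendsto (fun x => T x - N x) (inProb P) (𝓝 0) := tendsto_pi_nhds.2 hTN
    have h4 := ((tauM ν f Θ θ₀).continuous.tendsto 0).comp h3
    rwa [map_zero] at h4
  have h3 := h1.add h2
  rw [add_zero] at h3
  refine h3.congr' ?_
  filter_upwards [eventually_fst_pos] with x hn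
  have hsq : 0 < Real.sqrt x.1 := Real.sqrt_pos.2 (Nat.cast_pos.2 hn)
  have hsT : (Real.sqrt x.1)⁻¹ • T x = a x - mBar ν f Θ θ₀ := by
    simp only [T]
    rw [smul_smul, inv_mul_cancel₀ hsq.ne', one_smul]
  have hN : normSum Z (inflA ν f Θ θ₀) x.1 x.2 = tauM ν f Θ θ₀ (N x) := normSum_clm _ _ _ _
  have hb : biasHat f Θ Z x.1 x.2 (θhat x.1 x.2) = tau (a x) := rfl
  have hTx : tauM ν f Θ θ₀ (T x) = Real.sqrt x.1 * tauM ν f Θ θ₀ (a x - mBar ν f Θ θ₀) := by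
    simp only [T]
    rw [map_smul, smul_eq_mul]
  rw [hsT, hN, hb, h.bias_eq_tau_mBar, map_sub _ (T x), hTx, inv_inv, smul_eq_mul,
    add_sub_cancel]
  ring

/-! ### The bias-corrected estimators -/

/-- Given the third-order expansion of `θ̂`, subtracting `bEst / n` for any asymptotically linear
estimate `bEst` of `b₀` changes the second-order term by `b₀` and the third-order term by the
linearization of `bEst`. -/
lemma corrected_expansion (h : Regular ν f Θ θ₀) (hindep : iIndepFun Z P)
    (hlaw : ∀ i, HasLaw (Z i) (law ν f θ₀) P) (hmle : IsMLE P f Θ Z θhat)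
    {bEst : ℕ → Ω → ℝ} {b₀ : ℝ} {φ : 𝒵 → ℝ}
    (hb : Tendsto (fun x : ℕ × Ω => Real.sqrt x.1 * (bEst x.1 x.2 - b₀) - normSum Z φ x.1 x.2)
      (inProb P) (𝓝 0)) :
    IsLittleOp P (fun n ω => Real.sqrt n * ((θhat n ω - bEst n ω / n) - θ₀)
        - (A1 ν f Θ θ₀ Z n ω + 1 / Real.sqrt n * (A2 ν f Θ θ₀ Z n ω - b₀)
          + 1 / n * (A3 ν f Θ θ₀ Z n ω - normSum Z φ n ω))) (fun n => (n : ℝ)⁻¹) := by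
  refine (tendsto_inProb_iff (X := fun x : ℕ × Ω =>
    (Real.sqrt x.1 * ((θhat x.1 x.2 - bEst x.1 x.2 / x.1) - θ₀)
        - (A1 ν f Θ θ₀ Z x.1 x.2 + 1 / Real.sqrt x.1 * (A2 ν f Θ θ₀ Z x.1 x.2 - b₀)
          + 1 / x.1 * (A3 ν f Θ θ₀ Z x.1 x.2 - normSum Z φ x.1 x.2))) / (x.1 : ℝ)⁻¹)).1 ?_
  have h1 := ((h.mle_expansion hindep hlaw hmle).2).sub hb
  rw [sub_zero] at h1
  refine h1.congr' ?_
  filter_upwards [eventually_fst_pos] with x hn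
  have hn' : (0 : ℝ) < x.1 := Nat.cast_pos.2 hn
  have hsq : 0 < Real.sqrt x.1 := Real.sqrt_pos.2 hn'
  set q := Real.sqrt x.1 with hq
  have hqq : (x.1 : ℝ) = q ^ 2 := (Real.sq_sqrt hn'.le).symm
  rw [hqq]
  field_simp
  ring

end Regular

end BiasMLE

/-! ### Bias, asymptotic linearity and expansion of the corrected estimators -/

theorem mainTheorem8 {𝒵 Ω : Type*} [MeasurableSpace 𝒵] [MeasurableSpace Ω]
    (ν : Measure 𝒵) (f : 𝒵 → ℝ → ℝ) (Θ : Set ℝ) (θ₀ : ℝ)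
    (hreg : BiasMLE.Regular ν f Θ θ₀)
    (P : Measure Ω) [IsProbabilityMeasure P] (Z : ℕ → Ω → 𝒵)
    (hindep : iIndepFun Z P) (hlaw : ∀ i, HasLaw (Z i) (BiasMLE.law ν f θ₀) P)
    (θhat : ℕ → Ω → ℝ) (hmle : BiasMLE.IsMLE P f Θ Z θhat) :
    -- the higher-order bias `b₀ = E[A₂]` equals `b(θ₀)`
    (∀ n : ℕ, 1 ≤ n → Integrable (BiasMLE.A2 ν f Θ θ₀ Z n) P ∧
      ∫ ω, BiasMLE.A2 ν f Θ θ₀ Z n ω ∂P = BiasMLE.bias ν f Θ θ₀) ∧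
    -- asymptotic linearity of the two analytical bias estimates
    BiasMLE.AsymptoticallyLinear P (BiasMLE.law ν f θ₀) Z
      (fun n ω => BiasMLE.biasHat f Θ Z n ω (θhat n ω)) (BiasMLE.bias ν f Θ θ₀)
      (BiasMLE.inflA ν f Θ θ₀) ∧
    BiasMLE.AsymptoticallyLinear P (BiasMLE.law ν f θ₀) Z
      (fun n ω => BiasMLE.bias ν f Θ (θhat n ω)) (BiasMLE.bias ν f Θ θ₀)
      (BiasMLE.inflC ν f Θ θ₀) ∧
    -- expansion of the estimator that uses the integral version
    BiasMLE.IsLittleOp P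
      (fun n ω =>
        Real.sqrt n * ((θhat n ω - BiasMLE.bias ν f Θ (θhat n ω) / n) - θ₀)
        - (BiasMLE.A1 ν f Θ θ₀ Z n ω
          + 1 / Real.sqrt n * (BiasMLE.A2 ν f Θ θ₀ Z n ω - BiasMLE.bias ν f Θ θ₀)
          + 1 / n * (BiasMLE.A3 ν f Θ θ₀ Z n ω
              - BiasMLE.normSum Z (BiasMLE.inflC ν f Θ θ₀) n ω)))
      (fun n => (n : ℝ)⁻¹) ∧
    -- expansion of the estimator that uses the sample-average version
    BiasMLE.IsLittleOp P
      (fun n ω =>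
        Real.sqrt n * ((θhat n ω - BiasMLE.biasHat f Θ Z n ω (θhat n ω) / n) - θ₀)
        - (BiasMLE.A1 ν f Θ θ₀ Z n ω
          + 1 / Real.sqrt n * (BiasMLE.A2 ν f Θ θ₀ Z n ω - BiasMLE.bias ν f Θ θ₀)
          + 1 / n * (BiasMLE.A3 ν f Θ θ₀ Z n ω
              - BiasMLE.normSum Z (BiasMLE.inflA ν f Θ θ₀) n ω)))
      (fun n => (n : ℝ)⁻¹) := by
  have hhat := hreg.biasHat_linear hindep hlaw hmle
  have hint := hreg.bias_linear hindep hlaw hmle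
  exact ⟨fun n hn => hreg.integral_A2 hindep hlaw hn,
    BiasMLE.asymptoticallyLinear_of_tendsto hreg.memLp_inflA hreg.integral_inflA
      (bEst := fun n ω => BiasMLE.biasHat f Θ Z n ω (θhat n ω)) hhat,
    BiasMLE.asymptoticallyLinear_of_tendsto hreg.memLp_inflC hreg.integral_inflC
      (bEst := fun n ω => BiasMLE.bias ν f Θ (θhat n ω)) hint,
    hreg.corrected_expansion hindep hlaw hmle
      (bEst := fun n ω => BiasMLE.bias ν f Θ (θhat n ω)) hint,
    hreg.corrected_expansion hindep hlaw hmle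
      (bEst := fun n ω => BiasMLE.biasHat f Θ Z n ω (θhat n ω)) hhat⟩
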